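/- Let $p\in\{1,2,3\}$ and let $L^2(0,2\pi)$ be the real Hilbert space of square-integrable functions on $(0,2\pi)$. Let $A^{(p)}:L^2(0,2\pi)\to L^2(0,2\pi)$ be the bounded linear operator $$(A^{(p)}\varphi)(x)=\frac{1}{\Gamma(p)}\int_0^x (x-t)^{p-1}\varphi(t)\,dt,\qquad x\in(0,2\pi),$$ with range $\mathcal R(A^{(p)})$. For $n\in\mathbb N$ let $$X_n=\operatorname{span}\Big\{\tfrac{1}{\sqrt{2\pi}},\tfrac{\cos t}{\sqrt\pi},\tfrac{\sin t}{\sqrt\pi},\dots,\tfrac{\cos nt}{\sqrt\pi},\tfrac{\sin nt}{\sqrt\pi}\Big\},$$ let $P_n:L^2(0,2\pi)\to X_n$ be the orthogonal projection, and let $A_n^{(p)}:=P_nA^{(p)}P_n:X_n\to X_n$. Let $A_n^{(p)\dagger}:X_n\to X_n$ be its Moore–Penrose inverse: $A_n^{(p)\dagger}z$ is the element of smallest norm among the minimizers of $\|A_n^{(p)}x-z\|_{L^2}$ over $x\in X_n$. Let $H^p(0,2\pi)$ be the space of $y\in L^2(0,2\pi)$ whose weak derivatives of orders $1,\dots,p$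 lie in $L^2(0,2\pi)$; every such $y$ is identified with its representative in $C^{p-1}[0,2\pi]$ whose derivative of order $p-1$ has the form $\alpha+\int_0^x\Psi(t)\,dt$ with $\alpha\in\mathbb R$ and $\Psi\in L^2(0,2\pi)$. Put $$\mathcal H_0^p(0,2\pi)=\{y\in H^p(0,2\pi): y(0)=y'(0)=\dots=y^{(p-1)}(0)=0\}.$$ Then $\mathcal R(A^{(p)})=\mathcal H_0^p(0,2\pi)$, and for every $y\in L^2(0,2\pi)\setminus\mathcal R(A^{(p)})$, $$\|A_n^{(p)\dagger}P_ny\|_{L^2}\longrightarrow\infty\qquad(n\to\infty).$$ -/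

import Mathlib

open MeasureTheory Set Filter Topology
open scoped ENNReal ContDiff

noncomputable section

namespace NumDiff

/-! ### The Moore-Penrose inverse -/

section MoorePenrose

variable {X Y : Type*} [NormedAddCommGroup X] [InnerProductSpace ℝ X]
  [NormedAddCommGroup Y] [InnerProductSpace ℝ Y]

/-- `x` minimizes the residual `‖T x - y‖` over the whole space. -/
def IsLeastSquaresSolution (T : X →L[ℝ] Y) (y : Y) (x : X) : Prop :=
  ∀ z : X, ‖T x - y‖ ≤ ‖T z - y‖

/-- `x` is an element of smallest norm among the minimizers of the residual `‖T x - y‖`. -/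
def IsMoorePenroseSolution (T : X →L[ℝ] Y) (y : Y) (x : X) : Prop :=
  IsLeastSquaresSolution T y x ∧ ∀ z : X, IsLeastSquaresSolution T y z → ‖x‖ ≤ ‖z‖

/-- On a finite-dimensional space the least squares solution of smallest norm exists for every
right-hand side, and it is unique. -/
theorem existsUnique_isMoorePenroseSolution [FiniteDimensional ℝ X] (T : X →L[ℝ] Y) (y : Y) :
    ∃! x : X, IsMoorePenroseSolution T y x := by
  obtain ⟨x₀, hx₀⟩ : ∃ x₀ : X, T x₀ = T.range.starProjection y :=
    LinearMap.mem_range.1 (Submodule.starProjection_apply_mem T.range y)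
  have hpyth : ∀ z : X, ‖T z - y‖ ^ 2 = ‖T z - T x₀‖ ^ 2 + ‖T x₀ - y‖ ^ 2 := by
    intro z
    have h : inner ℝ (T z - T x₀) (T x₀ - y) = 0 := by
      have h1 : T z - T x₀ ∈ T.range := by
        rw [← map_sub]; exact LinearMap.mem_range.2 ⟨_, rfl⟩
      have h2 := Submodule.sub_starProjection_mem_orthogonal (K := T.range) y
      have h3 := (Submodule.mem_orthogonal _ _).1 h2 _ h1
      rw [← hx₀] at h3
      rw [← neg_sub y, inner_neg_right, h3, neg_zero]
    have h4 := norm_add_sq_eq_norm_sq_add_norm_sq_real h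
    rw [sub_add_sub_cancel] at h4
    nlinarith [h4]
  have hls : ∀ z : X, IsLeastSquaresSolution T y z ↔ T z = T x₀ := by
    intro z
    constructor
    · intro h
      have h1 := hpyth z
      have h2 : ‖T z - y‖ ^ 2 ≤ ‖T x₀ - y‖ ^ 2 := by gcongr; exact h x₀
      have h3 : ‖T z - T x₀‖ ^ 2 ≤ 0 := by linarith
      have h4 : ‖T z - T x₀‖ = 0 := by
        exact pow_eq_zero_iff (two_ne_zero) |>.1 (le_antisymm h3 (sq_nonneg _))
      exact sub_eq_zero.1 (norm_eq_zero.1 h4)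
    · intro h w
      have h1 := hpyth w
      rw [h]
      refine le_of_sq_le_sq ?_ (norm_nonneg _)
      nlinarith [sq_nonneg ‖T w - T x₀‖]
  obtain ⟨x, hx⟩ : ∃ x : X, x = x₀ - T.ker.starProjection x₀ := ⟨_, rfl⟩
  have hxo : x ∈ T.kerᗮ := by
    rw [hx]; exact Submodule.sub_starProjection_mem_orthogonal x₀
  have hTx : T x = T x₀ := by
    have h1 : T (T.ker.starProjection x₀) = 0 :=
      LinearMap.mem_ker.1 (Submodule.starProjection_apply_mem T.ker x₀)
    rw [hx, map_sub, h1, sub_zero]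
  have hnorm : ∀ z : X, T z = T x₀ → ‖z‖ ^ 2 = ‖z - x‖ ^ 2 + ‖x‖ ^ 2 := by
    intro z hz
    have h1 : z - x ∈ T.ker := by
      refine LinearMap.mem_ker.2 ?_
      change T (z - x) = 0
      rw [map_sub, hz, hTx, sub_self]
    have h2 := norm_add_sq_eq_norm_sq_add_norm_sq_real ((Submodule.mem_orthogonal _ _).1 hxo _ h1)
    rw [sub_add_cancel] at h2
    nlinarith [h2]
  refine ⟨x, ⟨(hls x).2 hTx, fun z hz => ?_⟩, ?_⟩
  · refine le_of_sq_le_sq ?_ (norm_nonneg _)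
    nlinarith [hnorm z ((hls z).1 hz), sq_nonneg ‖z - x‖]
  · rintro z ⟨hz1, hz2⟩
    have h1 := hnorm z ((hls z).1 hz1)
    have h2 : ‖z‖ ^ 2 ≤ ‖x‖ ^ 2 := by gcongr; exact hz2 x ((hls x).2 hTx)
    have h3 : ‖z - x‖ = 0 :=
      pow_eq_zero_iff (two_ne_zero) |>.1 (le_antisymm (by linarith) (sq_nonneg _))
    exact sub_eq_zero.1 (norm_eq_zero.1 h3)

/-- The Moore-Penrose inverse `T† : Y → X` of an operator on a finite-dimensional space: `T† y` is
the least squares solution of `T x = y` of smallest norm. -/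
def moorePenroseInverse [FiniteDimensional ℝ X] (T : X →L[ℝ] Y) (y : Y) : X :=
  (existsUnique_isMoorePenroseSolution T y).choose

theorem isMoorePenroseSolution_moorePenroseInverse [FiniteDimensional ℝ X] (T : X →L[ℝ] Y)
    (y : Y) : IsMoorePenroseSolution T y (moorePenroseInverse T y) :=
  (existsUnique_isMoorePenroseSolution T y).choose_spec.1

end MoorePenrose

/-! ### The space `L²(0, 2π)` and the integral operator -/

/-- Lebesgue measure on the interval `(0, 2π)`. -/
abbrev mu : Measure ℝ := volume.restrict (Ioo (0 : ℝ) (2 * Real.pi))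

/-- The real Hilbert space `L²(0, 2π)`. -/
abbrev L2 : Type := Lp ℝ 2 mu

/-- The function `x ↦ 1 / Γ(p) * ∫₀ˣ (x - t)^(p-1) φ(t) dt`, for an order `p ≥ 1`. -/
def integralFun (p : ℕ) (φ : ℝ → ℝ) (x : ℝ) : ℝ :=
  1 / Real.Gamma p * ∫ t in (0 : ℝ)..x, (x - t) ^ (p - 1) * φ t

theorem integrable_coeFn (φ : L2) : Integrable φ mu :=
  (Lp.memLp φ).integrable (by norm_num)

theorem integrableOn_coeFn (φ : L2) {x : ℝ} (hx : x ∈ Ioo (0 : ℝ) (2 * Real.pi)) :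
    IntegrableOn φ (Ioc 0 x) volume :=
  IntegrableOn.mono_set (t := Ioo (0 : ℝ) (2 * Real.pi)) (integrable_coeFn φ)
    fun _ ht => ⟨ht.1, ht.2.trans_lt hx.2⟩

theorem intervalIntegrable_kernel (p : ℕ) (φ : L2) {x : ℝ}
    (hx : x ∈ Ioo (0 : ℝ) (2 * Real.pi)) :
    IntervalIntegrable (fun t => (x - t) ^ (p - 1) * φ t) volume 0 x := by
  have h : IntervalIntegrable (φ : ℝ → ℝ) volume 0 x :=
    (intervalIntegrable_iff_integrableOn_Ioc_of_le hx.1.le).2 (integrableOn_coeFn φ hx)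
  exact h.continuousOn_mul (by fun_prop)

theorem aestronglyMeasurable_integralFun (p : ℕ) (φ : L2) :
    AEStronglyMeasurable (integralFun p φ) mu := by
  have hm : StronglyMeasurable (fun q : ℝ × ℝ =>
      ({q : ℝ × ℝ | 0 < q.2 ∧ q.2 ≤ q.1}.indicator
        (fun q => (q.1 - q.2) ^ (p - 1) * φ q.2) q)) := by
    refine StronglyMeasurable.indicator ?_ ?_
    · refine StronglyMeasurable.mul (Continuous.stronglyMeasurable (by fun_prop)) ?_
      exact (Lp.stronglyMeasurable φ).comp_measurable measurable_snd
    · exact (measurableSet_lt measurable_const measurable_snd).inter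
        (measurableSet_le measurable_snd measurable_fst)
  have hm2 := (hm.integral_prod_right' (ν := (volume : Measure ℝ))).const_mul (1 / Real.Gamma p)
  refine hm2.aestronglyMeasurable.congr ?_
  filter_upwards [ae_restrict_mem measurableSet_Ioo] with x hx
  rw [integralFun, intervalIntegral.integral_of_le hx.1.le, ← integral_indicator measurableSet_Ioc]
  rfl

theorem abs_integralFun_le (p : ℕ) (φ : L2) {x : ℝ} (hx : x ∈ Ioo (0 : ℝ) (2 * Real.pi)) :
    ‖integralFun p φ x‖ ≤ |1 / Real.Gamma p| * ((2 * Real.pi) ^ (p - 1) * ∫ t, ‖φ t‖ ∂mu) := by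
  rw [integralFun, norm_mul, Real.norm_eq_abs]
  refine mul_le_mul_of_nonneg_left ?_ (abs_nonneg _)
  rw [intervalIntegral.integral_of_le hx.1.le]
  calc ‖∫ t in Ioc 0 x, (x - t) ^ (p - 1) * φ t‖
      ≤ ∫ t in Ioc 0 x, (2 * Real.pi) ^ (p - 1) * ‖φ t‖ := by
        refine norm_integral_le_of_norm_le ((integrableOn_coeFn φ hx).norm.const_mul _) ?_
        filter_upwards [ae_restrict_mem measurableSet_Ioc] with t ht
        rw [norm_mul, norm_pow, Real.norm_eq_abs]
        refine mul_le_mul_of_nonneg_right (pow_le_pow_left₀ (abs_nonneg _) ?_ _) (norm_nonneg _)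
        rw [abs_of_nonneg (by linarith [ht.2])]
        linarith [ht.1, hx.2]
    _ = (2 * Real.pi) ^ (p - 1) * ∫ t in Ioc 0 x, ‖φ t‖ := integral_const_mul _ _
    _ ≤ (2 * Real.pi) ^ (p - 1) * ∫ t, ‖φ t‖ ∂mu := by
        refine mul_le_mul_of_nonneg_left ?_ (by positivity)
        refine setIntegral_mono_set (integrable_coeFn φ).norm
          (Eventually.of_forall fun _ => norm_nonneg _) ?_
        have hsub : Ioc 0 x ⊆ Ioo (0 : ℝ) (2 * Real.pi) :=
          fun _ ht => ⟨ht.1, ht.2.trans_lt hx.2⟩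
        exact Eventually.of_forall hsub

theorem memLp_integralFun (p : ℕ) (φ : L2) : MemLp (integralFun p φ) 2 mu := by
  refine MemLp.of_bound (aestronglyMeasurable_integralFun p φ)
    (|1 / Real.Gamma p| * ((2 * Real.pi) ^ (p - 1) * ∫ t, ‖φ t‖ ∂mu)) ?_
  filter_upwards [ae_restrict_mem measurableSet_Ioo] with x hx
  exact abs_integralFun_le p φ hx

theorem ae_eq_volume {f g : ℝ → ℝ} (h : f =ᵐ[mu] g) {x : ℝ}
    (hx : x ∈ Ioo (0 : ℝ) (2 * Real.pi)) : f =ᵐ[volume.restrict (Ioc 0 x)] g := by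
  have hsub : Ioc 0 x ⊆ Ioo (0 : ℝ) (2 * Real.pi) := fun _ ht => ⟨ht.1, ht.2.trans_lt hx.2⟩
  exact ae_mono (Measure.restrict_mono hsub le_rfl) h

/-- The operator as a linear map on `L²(0, 2π)`. -/
def integralLinearMap (p : ℕ) : L2 →ₗ[ℝ] L2 where
  toFun φ := (memLp_integralFun p φ).toLp (integralFun p φ)
  map_add' φ ψ := by
    rw [← MemLp.toLp_add (memLp_integralFun p φ) (memLp_integralFun p ψ)]
    refine MemLp.toLp_congr _ _ ?_
    filter_upwards [ae_restrict_mem measurableSet_Ioo] with x hx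
    have h1 : (∫ t in (0 : ℝ)..x, (x - t) ^ (p - 1) * (φ + ψ : L2) t) =
        ∫ t in (0 : ℝ)..x, ((x - t) ^ (p - 1) * φ t + (x - t) ^ (p - 1) * ψ t) := by
      rw [intervalIntegral.integral_of_le hx.1.le, intervalIntegral.integral_of_le hx.1.le]
      refine integral_congr_ae ?_
      filter_upwards [ae_eq_volume (Lp.coeFn_add φ ψ) hx] with t ht
      rw [ht, Pi.add_apply, mul_add]
    rw [Pi.add_apply, integralFun, h1, intervalIntegral.integral_add
      (intervalIntegrable_kernel p φ hx) (intervalIntegrable_kernel p ψ hx), mul_add]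
    rfl
  map_smul' c φ := by
    rw [RingHom.id_apply, ← MemLp.toLp_const_smul c (memLp_integralFun p φ)]
    refine MemLp.toLp_congr _ _ ?_
    filter_upwards [ae_restrict_mem measurableSet_Ioo] with x hx
    have h1 : (∫ t in (0 : ℝ)..x, (x - t) ^ (p - 1) * (c • φ : L2) t) =
        ∫ t in (0 : ℝ)..x, c * ((x - t) ^ (p - 1) * φ t) := by
      rw [intervalIntegral.integral_of_le hx.1.le, intervalIntegral.integral_of_le hx.1.le]
      refine integral_congr_ae ?_
      filter_upwards [ae_eq_volume (Lp.coeFn_smul c φ) hx] with t ht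
      rw [ht, Pi.smul_apply, smul_eq_mul]
      ring
    rw [Pi.smul_apply, integralFun, h1, intervalIntegral.integral_const_mul, smul_eq_mul,
      integralFun]
    ring

theorem integral_norm_le (φ : L2) :
    ∫ t, ‖φ t‖ ∂mu ≤ (mu univ).toReal ^ (1 / 2 : ℝ) * ‖φ‖ := by
  have h := eLpNorm_le_eLpNorm_mul_rpow_measure_univ (p := 1) (q := 2) (μ := mu)
    (by norm_num) (Lp.aestronglyMeasurable φ)
  have h2 := ENNReal.toReal_mono (ENNReal.mul_ne_top (Lp.eLpNorm_ne_top φ)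
    (ENNReal.rpow_ne_top_of_nonneg (by norm_num) (measure_ne_top mu univ))) h
  rw [ENNReal.toReal_mul, eLpNorm_one_eq_lintegral_enorm,
    ← integral_norm_eq_lintegral_enorm (Lp.aestronglyMeasurable φ), ← Lp.norm_def,
    ← ENNReal.toReal_rpow] at h2
  refine h2.trans (le_of_eq ?_)
  norm_num [mul_comm]

/-- The bounded operator `A^{(p)} : L²(0, 2π) → L²(0, 2π)`,
`(A^{(p)} φ)(x) = 1 / Γ(p) * ∫₀ˣ (x - t)^(p-1) φ(t) dt`. -/
def opA (p : ℕ) : L2 →L[ℝ] L2 :=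
  (integralLinearMap p).mkContinuous
    ((mu univ).toReal ^ (1 / 2 : ℝ) * (|1 / Real.Gamma p| *
      ((2 * Real.pi) ^ (p - 1) * (mu univ).toReal ^ (1 / 2 : ℝ)))) (by
    intro φ
    have h : ∀ᵐ x ∂mu, ‖integralLinearMap p φ x‖ ≤
        |1 / Real.Gamma p| * ((2 * Real.pi) ^ (p - 1) * ∫ t, ‖φ t‖ ∂mu) := by
      filter_upwards [ae_restrict_mem measurableSet_Ioo,
        (memLp_integralFun p φ).coeFn_toLp] with x hx hx2
      exact (congrArg norm hx2).trans_le (abs_integralFun_le p φ hx)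
    have h0 : 0 ≤ ∫ t, ‖φ t‖ ∂mu := integral_nonneg fun _ => norm_nonneg _
    refine (Lp.norm_le_of_ae_bound (by positivity) h).trans ?_
    have h3 : ((measureUnivNNReal mu : ℝ) ^ ((2 : ℝ≥0∞).toReal)⁻¹) =
        (mu univ).toReal ^ (1 / 2 : ℝ) := by
      norm_num [measureUnivNNReal]
      rfl
    rw [h3, mul_assoc, mul_assoc, mul_assoc]
    gcongr
    exact integral_norm_le φ)

/-! ### Trigonometric subspaces and the Galerkin scheme -/

theorem memLp_of_continuous {f : ℝ → ℝ} (hf : Continuous f) : MemLp f 2 mu := by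
  obtain ⟨C, hC⟩ := (isCompact_Icc (a := (0 : ℝ)) (b := 2 * Real.pi)).exists_bound_of_continuousOn
    hf.continuousOn
  refine MemLp.of_bound hf.aestronglyMeasurable C ?_
  filter_upwards [ae_restrict_mem measurableSet_Ioo] with x hx
  exact hC x (Ioo_subset_Icc_self hx)

/-- The normalized constant function `1 / √(2π)`. -/
def constVec : L2 :=
  (memLp_of_continuous (f := fun _ => 1 / √(2 * Real.pi)) (by fun_prop)).toLp _

/-- The normalized function `t ↦ cos (k t) / √π`. -/
def cosVec (k : ℕ) : L2 :=
  (memLp_of_continuous (f := fun t => Real.cos (k * t) / √Real.pi) (by fun_prop)).toLp _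

/-- The normalized function `t ↦ sin (k t) / √π`. -/
def sinVec (k : ℕ) : L2 :=
  (memLp_of_continuous (f := fun t => Real.sin (k * t) / √Real.pi) (by fun_prop)).toLp _

/-- The space `X_n` spanned by `1 / √(2π)` and `cos (k t) / √π`, `sin (k t) / √π`, `1 ≤ k ≤ n`. -/
def trigSpace (n : ℕ) : Submodule ℝ L2 :=
  Submodule.span ℝ ({constVec} ∪ cosVec '' Icc 1 n ∪ sinVec '' Icc 1 n)

instance instFiniteDimensionalTrigSpace (n : ℕ) : FiniteDimensional ℝ (trigSpace n) :=
  FiniteDimensional.span_of_finite ℝ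
    (((finite_singleton _).union ((finite_Icc 1 n).image _)).union ((finite_Icc 1 n).image _))

/-- The orthogonal projection `P_n : L²(0, 2π) → X_n`. -/
def projP (n : ℕ) : L2 →L[ℝ] trigSpace n :=
  (trigSpace n).orthogonalProjectionOnto

/-- The Galerkin operator `A_n^{(p)} = P_n A^{(p)} P_n : X_n → X_n`; the right-hand `P_n` is the
inclusion of `X_n`, since `P_n` is the identity on `X_n`. -/
def galerkinOp (p n : ℕ) : trigSpace n →L[ℝ] trigSpace n :=
  (projP n).comp ((opA p).comp (trigSpace n).subtypeL)

/-! ### Sobolev spaces -/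

/-- `ζ` is the weak derivative of order `k` of `y` on `(0, 2π)`. -/
def IsWeakDeriv (k : ℕ) (y ζ : L2) : Prop :=
  ∀ φ : ℝ → ℝ, ContDiff ℝ ∞ φ → HasCompactSupport φ → tsupport φ ⊆ Ioo 0 (2 * Real.pi) →
    ∫ x, ζ x * φ x ∂mu = (-1) ^ k * ∫ x, y x * iteratedDeriv k φ x ∂mu

/-- The Sobolev space `H^p(0, 2π)`: all weak derivatives of order `1, …, p` lie in `L²(0, 2π)`. -/
def sobolevH (p : ℕ) : Set L2 :=
  {y | ∀ k ∈ Icc 1 p, ∃ ζ : L2, IsWeakDeriv k y ζ}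

/-- The functions `u ∈ C^{p-1}[0, 2π]` with `u^{(p-1)}(x) = α + ∫₀ˣ Ψ(t) dt` on `[0, 2π]` for some
`α ∈ ℝ` and `Ψ ∈ L²(0, 2π)`, for an order `p ≥ 1`. -/
def fineU (p : ℕ) : Set (ℝ → ℝ) :=
  {u | ContDiffOn ℝ ((p - 1 : ℕ) : ℕ∞) u (Icc 0 (2 * Real.pi)) ∧
    ∃ (α : ℝ) (Ψ : ℝ → ℝ), MemLp Ψ 2 mu ∧ ∀ x ∈ Icc 0 (2 * Real.pi),
      iteratedDerivWithin (p - 1) u (Icc 0 (2 * Real.pi)) x = α + ∫ t in (0 : ℝ)..x, Ψ t}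

/-- The space `𝓗₀^p(0, 2π)` of all `y ∈ H^p(0, 2π)` with `y(0) = ⋯ = y^{(p-1)}(0) = 0`. The pointwise
values at `0` are those of the representative of `y` in `fineU p`, which is unique on `[0, 2π]`
because two continuous functions that agree almost everywhere there are equal. -/
def sobolevH0 (p : ℕ) : Set L2 :=
  {y | y ∈ sobolevH p ∧ ∃ u ∈ fineU p, y =ᵐ[mu] u ∧
    ∀ k < p, iteratedDerivWithin k u (Icc 0 (2 * Real.pi)) 0 = 0}

end NumDiff

end

noncomputable section

namespace NumDiff

/-! ### The integral operator as an iterated primitive -/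

section Primitive

variable {f g : ℝ → ℝ} {p : ℕ} {x b : ℝ}

/-! The range. `A^{(p)}` is the `p`-fold primitive with base point `0` (`integralFun_succ`). Hence
`A^{(p)} φ` has weak derivatives `A^{(p-k)} φ` for `k < p`, then `φ`, and zero initial data.
Conversely, a function with zero initial data whose derivative of order `p - 1` is a primitive of
`Ψ`, up to a constant, is recovered by integrating `p` times (`range_opA`).

Divergence. Suppose the Galerkin operators are injective, hence bijective on the finite-dimensional
`X_n`. Then `x_n = A_n† P_n y` satisfies `⟨A x_n, w⟩ = ⟨y, w⟩` for all `w ∈ X_n`. If `‖x_n‖` did not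
tend to infinity, some weak limit `x₀` of the `x_n` would exist. Taking `w = P_n z → z` gives `A x₀
= y`, so `y` lies in the range (`tendsto_norm_moorePenroseInverse_atTop`). Density of the
trigonometric polynomials comes from Parseval.

Injectivity is the core (`galerkinOp_injective`). Let `φ ∈ X_n` with `A^{(p)} φ ⟂ X_n`. Integrating
by parts `p` times, the moments of `φ` against `cos kx` and `sin kx`, `k ≤ n`, become polynomials in
`k` whose coefficients are the values at `2π` of the first `p` primitives of `φ`. These are the
moments of a combination of the Dirichlet kernel and its first two derivatives, so `φ` equals that
combination (`ae_eq_of_moments`). Integrating it explicitly (`iterate_primitive_two_pi`) expresses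
the same endpoint values in terms of themselves. With the vanishing of primitive number `p + 1` at
`2π`, this is a homogeneous linear system. It has only the zero solution, because `(n + 1/2) ∑_{k>n}
1/k² ≤ 1` (`add_half_mul_zetaTwo_tail_le`) while `π² > 8`. -/

theorem two_pi_nonneg : (0 : ℝ) ≤ 2 * Real.pi := by positivity

theorem intervalIntegrable_of_memLp (hf : MemLp f 2 mu) :
    IntervalIntegrable f volume 0 (2 * Real.pi) := by
  rw [intervalIntegrable_iff_integrableOn_Ioo_of_le two_pi_nonneg]
  exact hf.integrable (by norm_num)

theorem intervalIntegrable_mono_Icc (hf : IntervalIntegrable f volume 0 b) (hx : x ∈ Icc 0 b) :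
    IntervalIntegrable f volume 0 x := by
  refine hf.mono_set ?_
  rw [uIcc_of_le hx.1, uIcc_of_le (hx.1.trans hx.2)]
  exact Icc_subset_Icc_right hx.2

theorem continuousOn_primitive_Icc (hf : IntervalIntegrable f volume 0 b) (hb : 0 ≤ b) :
    ContinuousOn (fun x => ∫ t in (0 : ℝ)..x, f t) (Icc 0 b) := by
  have h := intervalIntegral.continuousOn_primitive_interval' hf left_mem_uIcc
  rwa [uIcc_of_le hb] at h

/-- Integration by parts against the primitive of an integrable function. -/
theorem integral_mul_eq_primitive {g' : ℝ → ℝ} (hf : IntervalIntegrable f volume 0 b)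
    (hg : ∀ x, HasDerivAt g (g' x) x) (hg' : Continuous g') :
    ∫ t in (0 : ℝ)..b, g t * f t = g b * (∫ t in (0 : ℝ)..b, f t) -
      ∫ t in (0 : ℝ)..b, g' t * ∫ s in (0 : ℝ)..t, f s := by
  have hd : deriv g = g' := funext fun x => (hg x).deriv
  have hgc : ContDiff ℝ 1 g :=
    contDiff_one_iff_deriv.2 ⟨fun x => (hg x).differentiableAt, hd ▸ hg'⟩
  -- The primitive of a merely integrable `f` is absolutely continuous and differentiable only
  -- almost everywhere, so the classical `C¹` version of integration by parts does not apply.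
  have h := AbsolutelyContinuousOnInterval.integral_mul_deriv_eq_deriv_mul
    (hgc.contDiffOn (s := uIcc 0 b)).absolutelyContinuousOnInterval
    (hf.absolutelyContinuousOnInterval_intervalIntegral left_mem_uIcc)
  rw [hd, intervalIntegral.integral_same, mul_zero, sub_zero] at h
  rw [← h]
  refine intervalIntegral.integral_congr_ae ?_
  filter_upwards [hf.ae_hasDerivAt_integral] with t ht ht'
  rw [(ht (uIoc_subset_uIcc ht') 0 left_mem_uIcc).deriv]

theorem integralFun_zero_right : integralFun p f 0 = 0 := by
  simp [integralFun]

theorem integralFun_one : integralFun 1 f x = ∫ t in (0 : ℝ)..x, f t := by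
  simp [integralFun]

theorem integralFun_congr_ae (h : f =ᵐ[mu] g) (hx : x ∈ Ioo (0 : ℝ) (2 * Real.pi)) :
    integralFun p f x = integralFun p g x := by
  rw [integralFun, integralFun, intervalIntegral.integral_of_le hx.1.le,
    intervalIntegral.integral_of_le hx.1.le]
  congr 1
  refine integral_congr_ae ?_
  filter_upwards [ae_eq_volume h hx] with t ht
  rw [ht]

/-- Integration by parts: the boundary term dies at `t = x` because `p ≥ 1`, and at `t = 0` because
the primitive vanishes there. The factor `p` from the kernel is absorbed by `Γ(p + 1) = p Γ(p)`. -/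
theorem integralFun_succ_eq_integralFun_primitive (hp : 1 ≤ p)
    (hf : IntervalIntegrable f volume 0 x) :
    integralFun (p + 1) f x = integralFun p (fun s => ∫ t in (0 : ℝ)..s, f t) x := by
  have hg : ∀ t : ℝ, HasDerivAt (fun t => (x - t) ^ p) (-(p * (x - t) ^ (p - 1))) t := by
    intro t
    have h := ((hasDerivAt_id t).const_sub x).fun_pow p
    simpa using h
  have h := integral_mul_eq_primitive hf hg (by fun_prop)
  have hp0 : (p : ℝ) ≠ 0 := by positivity
  simp only [integralFun, Nat.add_sub_cancel]
  rw [h, sub_self, zero_pow (by omega), zero_mul, zero_sub]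
  simp only [neg_mul, mul_assoc]
  rw [intervalIntegral.integral_neg, neg_neg, intervalIntegral.integral_const_mul]
  push_cast
  rw [Real.Gamma_add_one hp0]
  have hG : Real.Gamma p ≠ 0 := (Real.Gamma_pos_of_pos (by positivity)).ne'
  field_simp

/-- Integrating before or after gives the same function: one order is traded for an inner primitive,
the induction hypothesis is applied to that primitive, and the trade is reversed under the integral
sign. This is why the induction varies `f`. -/
theorem integralFun_succ (hp : 1 ≤ p) (hb : 0 ≤ b) (hf : IntervalIntegrable f volume 0 b) :
    integralFun (p + 1) f b = ∫ t in (0 : ℝ)..b, integralFun p f t := by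
  induction p, hp using Nat.le_induction generalizing f with
  | base =>
    rw [integralFun_succ_eq_integralFun_primitive le_rfl hf]
    simp only [integralFun_one]
  | succ p hp ih =>
    have hc : ContinuousOn (fun x => ∫ t in (0 : ℝ)..x, f t) (uIcc 0 b) := by
      rw [uIcc_of_le hb]; exact continuousOn_primitive_Icc hf hb
    rw [integralFun_succ_eq_integralFun_primitive (by omega) hf, ih hc.intervalIntegrable]
    refine intervalIntegral.integral_congr fun t ht => ?_
    rw [uIcc_of_le hb] at ht
    exact (integralFun_succ_eq_integralFun_primitive hp (intervalIntegrable_mono_Icc hf ht)).symm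

theorem continuousOn_integralFun (hp : 1 ≤ p) (hb : 0 ≤ b)
    (hf : IntervalIntegrable f volume 0 b) : ContinuousOn (integralFun p f) (Icc 0 b) := by
  induction p, hp using Nat.le_induction with
  | base =>
    exact (continuousOn_primitive_Icc hf hb).congr fun x _ => integralFun_one
  | succ p hp ih =>
    refine (continuousOn_primitive_Icc (ih.intervalIntegrable_of_Icc hb) hb).congr fun x hx => ?_
    exact integralFun_succ hp hx.1 (intervalIntegrable_mono_Icc hf hx)

/-- From order `1` on the function is continuous even for rough `f`, so the fundamental theorem of
calculus holds at every point, one-sidedly at the endpoints. -/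
theorem hasDerivWithinAt_integralFun_succ (hp : 1 ≤ p) (hf : IntervalIntegrable f volume 0 b)
    (hx : x ∈ Icc 0 b) :
    HasDerivWithinAt (integralFun (p + 1) f) (integralFun p f x) (Icc 0 b) x := by
  have hb : 0 ≤ b := hx.1.trans hx.2
  have hc := continuousOn_integralFun hp hb hf
  have : Fact (x ∈ Icc 0 b) := ⟨hx⟩
  have h := intervalIntegral.integral_hasDerivWithinAt_right (s := Icc 0 b) (t := Icc 0 b)
    (intervalIntegrable_mono_Icc (hc.intervalIntegrable_of_Icc hb) hx)
    (hc.stronglyMeasurableAtFilter_nhdsWithin measurableSet_Icc x) (hc x hx)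
  exact h.congr (fun y hy => integralFun_succ hp hy.1 (intervalIntegrable_mono_Icc hf hy))
    (integralFun_succ hp hx.1 (intervalIntegrable_mono_Icc hf hx))

theorem iteratedDerivWithin_integralFun {k q : ℕ} (hq : 1 ≤ q) (hb : 0 < b)
    (hf : IntervalIntegrable f volume 0 b) (hx : x ∈ Icc 0 b) :
    iteratedDerivWithin k (integralFun (q + k) f) (Icc 0 b) x = integralFun q f x := by
  induction k generalizing q x with
  | zero => simp
  | succ k ih =>
    rw [iteratedDerivWithin_succ]
    have h := (hasDerivWithinAt_integralFun_succ hq hf hx).derivWithin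
      (uniqueDiffOn_Icc hb x hx)
    rw [← h]
    refine derivWithin_congr (fun y hy => ?_) ?_
    · rw [← ih (q := q + 1) (by omega) hy, add_right_comm, add_assoc]
    · rw [← ih (q := q + 1) (by omega) hx, add_right_comm, add_assoc]

theorem contDiffOn_integralFun (hp : 1 ≤ p) (hb : 0 < b) (hf : IntervalIntegrable f volume 0 b) :
    ContDiffOn ℝ ((p - 1 : ℕ) : ℕ∞) (integralFun p f) (Icc 0 b) := by
  have key : ∀ m, m < p → ∀ x ∈ Icc 0 b,
      iteratedDerivWithin m (integralFun p f) (Icc 0 b) x = integralFun (p - m) f x := by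
    intro m hm x hx
    have h := iteratedDerivWithin_integralFun (k := m) (q := p - m) (by omega) hb hf hx
    rwa [Nat.sub_add_cancel hm.le] at h
  have h : ContDiffOn ℝ (p - 1 : ℕ) (integralFun p f) (Icc 0 b) := by
    rw [contDiffOn_nat_iff_continuousOn_differentiableOn_deriv (uniqueDiffOn_Icc hb)]
    refine ⟨fun m hm => ?_, fun m hm => ?_⟩
    · exact (continuousOn_integralFun (by omega) hb.le hf).congr (key m (by omega))
    · refine DifferentiableOn.congr (fun x hx => ?_) (key m (by omega))
      obtain ⟨q, hq⟩ : ∃ q, p - m = q + 1 := ⟨p - m - 1, by omega⟩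
      rw [hq]
      exact (hasDerivWithinAt_integralFun_succ (by omega) hf hx).differentiableWithinAt
  exact_mod_cast h

theorem integralFun_mem_fineU (hp : 1 ≤ p) (hf : MemLp f 2 mu) : integralFun p f ∈ fineU p := by
  have hi := intervalIntegrable_of_memLp hf
  refine ⟨contDiffOn_integralFun hp (by positivity) hi, 0, f, hf, fun x hx => ?_⟩
  have h := iteratedDerivWithin_integralFun (k := p - 1) (q := 1) le_rfl (by positivity) hi hx
  rw [Nat.add_sub_cancel' hp] at h
  rw [h, integralFun_one, zero_add]

/-- A function in `fineU p` whose derivatives of order less than `p` vanish at `0` is an iterated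
primitive. -/
theorem exists_eqOn_integralFun_of_mem_fineU {u : ℝ → ℝ} (hp : 1 ≤ p) (hu : u ∈ fineU p)
    (h0 : ∀ k < p, iteratedDerivWithin k u (Icc 0 (2 * Real.pi)) 0 = 0) :
    ∃ Ψ : ℝ → ℝ, MemLp Ψ 2 mu ∧ EqOn u (integralFun p Ψ) (Icc 0 (2 * Real.pi)) := by
  obtain ⟨hc, α, Ψ, hΨ, h⟩ := hu
  have hpi : (0 : ℝ) < 2 * Real.pi := by positivity
  have hi := intervalIntegrable_of_memLp hΨ
  -- `α` is the value at `0` of the derivative of order `p - 1`.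
  have hα : α = 0 := by
    have h1 := h 0 (left_mem_Icc.2 hpi.le)
    rw [h0 _ (by omega), intervalIntegral.integral_same, add_zero] at h1
    exact h1.symm
  refine ⟨Ψ, hΨ, ?_⟩
  have hc' : ContDiffOn ℝ (p - 1 : ℕ) u (Icc 0 (2 * Real.pi)) := by exact_mod_cast hc
  rw [contDiffOn_nat_iff_continuousOn_differentiableOn_deriv (uniqueDiffOn_Icc hpi)] at hc'
  -- Descent from the top derivative: `k` counts how many integrations separate `m` from `p - 1`,
  -- and each one uses the zero initial value of the derivative of order `m`.
  have key : ∀ k m, k + m = p - 1 → ∀ x ∈ Icc 0 (2 * Real.pi),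
      iteratedDerivWithin m u (Icc 0 (2 * Real.pi)) x = integralFun (k + 1) Ψ x := by
    intro k
    induction k with
    | zero =>
      intro m hm x hx
      obtain rfl : m = p - 1 := by omega
      rw [h x hx, hα, zero_add, zero_add, integralFun_one]
    | succ k ih =>
      intro m hm x hx
      have hd := ih (m + 1) (by omega)
      have hci : ContinuousOn (integralFun (k + 1) Ψ) (Icc 0 x) :=
        (continuousOn_integralFun (by omega) hpi.le hi).mono (Icc_subset_Icc_right hx.2)
      rw [integralFun_succ (by omega) hx.1 (intervalIntegrable_mono_Icc hi hx),
        intervalIntegral.integral_eq_sub_of_hasDerivAt_of_le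
          (f := iteratedDerivWithin m u (Icc 0 (2 * Real.pi))) hx.1
          ((hc'.1 m (by omega)).mono (Icc_subset_Icc_right hx.2)) (fun y hy => ?_)
          (hci.intervalIntegrable_of_Icc hx.1), h0 m (by omega), sub_zero]
      have hy' : y ∈ Icc 0 (2 * Real.pi) := ⟨hy.1.le, hy.2.le.trans hx.2⟩
      rw [← hd y hy', iteratedDerivWithin_succ]
      exact (hc'.2 m (by omega) y hy').hasDerivWithinAt.hasDerivAt
        (Icc_mem_nhds hy.1 (hy.2.trans_le hx.2))
  intro x hx
  have h1 := key (p - 1) 0 (by omega) x hx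
  rwa [iteratedDerivWithin_zero, Nat.sub_add_cancel hp] at h1

end Primitive

theorem opA_coeFn (p : ℕ) (φ : L2) : opA p φ =ᵐ[mu] integralFun p φ :=
  (memLp_integralFun p φ).coeFn_toLp

theorem integral_mu (f : ℝ → ℝ) : ∫ x, f x ∂mu = ∫ x in (0 : ℝ)..(2 * Real.pi), f x := by
  rw [intervalIntegral.integral_of_le two_pi_nonneg, integral_Ioc_eq_integral_Ioo]

/-! ### Weak derivatives -/

/-- No boundary term survives: the test function vanishes at `2π` and the primitive at `0`. -/
theorem isWeakDeriv_one_of_ae_primitive {y ζ : L2} {f : ℝ → ℝ} (hζ : ζ =ᵐ[mu] f)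
    (hy : y =ᵐ[mu] fun x => ∫ t in (0 : ℝ)..x, f t) : IsWeakDeriv 1 y ζ := by
  intro φ hφ _ hsupp
  have hf : IntervalIntegrable f volume 0 (2 * Real.pi) :=
    intervalIntegrable_of_memLp ((memLp_congr_ae hζ).1 (Lp.memLp ζ))
  have hend : φ (2 * Real.pi) = 0 := by
    by_contra h
    exact lt_irrefl _ (hsupp (subset_tsupport φ h)).2
  have h := integral_mul_eq_primitive hf (g := φ) (g' := deriv φ)
    (fun x => ((hφ.differentiable (by simp)) x).hasDerivAt) (hφ.continuous_deriv (by simp))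
  rw [hend, zero_mul, zero_sub] at h
  have h1 : ∫ x, ζ x * φ x ∂mu = ∫ x, φ x * f x ∂mu :=
    integral_congr_ae (hζ.mono fun x hx => by simp only [hx, mul_comm])
  have h2 : ∫ x, y x * iteratedDeriv 1 φ x ∂mu =
      ∫ x, deriv φ x * (∫ t in (0 : ℝ)..x, f t) ∂mu :=
    integral_congr_ae (hy.mono fun x hx => by simp only [hx, iteratedDeriv_one, mul_comm])
  rw [h1, h2, integral_mu, integral_mu, h]
  ring

theorem IsWeakDeriv.succ {k : ℕ} {y ζ ξ : L2} (h : IsWeakDeriv k y ζ) (h1 : IsWeakDeriv 1 ζ ξ) :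
    IsWeakDeriv (k + 1) y ξ := by
  intro φ hφ hc hsupp
  have hφ' : ContDiff ℝ ∞ (deriv φ) := (contDiff_infty_iff_deriv.1 hφ).2
  have hts : tsupport (deriv φ) ⊆ tsupport φ := tsupport_deriv_subset
  rw [h1 φ hφ hc hsupp, iteratedDeriv_one,
    h (deriv φ) hφ' hc.deriv (hts.trans hsupp),
    iteratedDeriv_succ']
  ring

theorem isWeakDeriv_opA_one (φ : L2) : IsWeakDeriv 1 (opA 1 φ) φ :=
  isWeakDeriv_one_of_ae_primitive (EventuallyEq.refl _ _)
    ((opA_coeFn 1 φ).trans (Eventually.of_forall fun _ => integralFun_one))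

theorem isWeakDeriv_opA_succ {q : ℕ} (hq : 1 ≤ q) (φ : L2) :
    IsWeakDeriv 1 (opA (q + 1) φ) (opA q φ) := by
  refine isWeakDeriv_one_of_ae_primitive (opA_coeFn q φ) ((opA_coeFn (q + 1) φ).trans ?_)
  filter_upwards [ae_restrict_mem measurableSet_Ioo] with x hx
  exact integralFun_succ hq hx.1.le (intervalIntegrable_mono_Icc
    (intervalIntegrable_of_memLp (Lp.memLp φ)) (Ioo_subset_Icc_self hx))

theorem isWeakDeriv_opA_add {k q : ℕ} (hk : 1 ≤ k) (hq : 1 ≤ q) (φ : L2) :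
    IsWeakDeriv k (opA (q + k) φ) (opA q φ) := by
  induction k, hk using Nat.le_induction generalizing q with
  | base => exact isWeakDeriv_opA_succ hq φ
  | succ k hk ih =>
    have h := ih (q := q + 1) (by omega)
    rw [add_right_comm, add_assoc] at h
    exact h.succ (isWeakDeriv_opA_succ hq φ)

theorem isWeakDeriv_opA_self {p : ℕ} (hp : 1 ≤ p) (φ : L2) : IsWeakDeriv p (opA p φ) φ := by
  obtain ⟨k, rfl⟩ : ∃ k, p = 1 + k := ⟨p - 1, by omega⟩
  rcases Nat.eq_zero_or_pos k with rfl | hk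
  · exact isWeakDeriv_opA_one φ
  · have h := (isWeakDeriv_opA_add hk le_rfl φ).succ (isWeakDeriv_opA_one φ)
    rwa [add_comm k 1] at h

theorem opA_mem_sobolevH {p : ℕ} (φ : L2) : opA p φ ∈ sobolevH p := by
  intro k hk
  -- The top order is separate: `opA 0` is the zero operator, not the identity, since `Real.Gamma 0
  -- = 0` and `1 / 0 = 0`.
  rcases hk.2.eq_or_lt with rfl | hlt
  · exact ⟨φ, isWeakDeriv_opA_self hk.1 φ⟩
  · have h := isWeakDeriv_opA_add hk.1 (q := p - k) (by omega) φ
    rw [Nat.sub_add_cancel hlt.le] at h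
    exact ⟨_, h⟩

/-- The range of the integral operator of order `p`. -/
theorem range_opA {p : ℕ} (hp : 1 ≤ p) : Set.range (opA p) = sobolevH0 p := by
  ext y
  constructor
  · rintro ⟨φ, rfl⟩
    refine ⟨opA_mem_sobolevH φ, integralFun p φ, integralFun_mem_fineU hp (Lp.memLp φ),
      opA_coeFn p φ, fun k hk => ?_⟩
    have h := iteratedDerivWithin_integralFun (k := k) (q := p - k) (by omega)
      (by positivity) (intervalIntegrable_of_memLp (Lp.memLp φ)) (left_mem_Icc.2 two_pi_nonneg)
    rw [Nat.sub_add_cancel hk.le] at h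
    rw [h, integralFun_zero_right]
  · rintro ⟨_, u, hu, hyu, h0⟩
    obtain ⟨Ψ, hΨ, hE⟩ := exists_eqOn_integralFun_of_mem_fineU hp hu h0
    refine ⟨hΨ.toLp Ψ, Lp.ext ?_⟩
    filter_upwards [opA_coeFn p (hΨ.toLp Ψ), hyu, ae_restrict_mem measurableSet_Ioo]
      with x h1 h2 hx
    rw [h1, h2, hE (Ioo_subset_Icc_self hx), integralFun_congr_ae hΨ.coeFn_toLp hx]

/-! ### Divergence of the projection scheme outside the range -/

section Divergence

variable {X Y H : Type*} [NormedAddCommGroup X] [InnerProductSpace ℝ X]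
  [NormedAddCommGroup Y] [InnerProductSpace ℝ Y] [NormedAddCommGroup H] [InnerProductSpace ℝ H]

theorem apply_moorePenroseInverse [FiniteDimensional ℝ X] (T : X →L[ℝ] Y)
    (hT : Function.Surjective T) (y : Y) : T (moorePenroseInverse T y) = y := by
  obtain ⟨w, hw⟩ := hT y
  have h := (isMoorePenroseSolution_moorePenroseInverse T y).1 w
  rw [hw, sub_self, norm_zero] at h
  exact sub_eq_zero.1 (norm_le_zero_iff.1 h)

/-- A sequence that is bounded by `M` infinitely often has a weak limit along an ultrafilter. -/
theorem exists_ultrafilter_weak_limit [CompleteSpace H] {x : ℕ → H} {M : ℝ}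
    (hx : ∃ᶠ n in atTop, ‖x n‖ ≤ M) :
    ∃ (F : Ultrafilter ℕ) (x₀ : H), (F : Filter ℕ) ≤ atTop ∧ (∀ᶠ n in F, ‖x n‖ ≤ M) ∧
      ∀ z, Tendsto (fun n => inner ℝ (x n) z) F (𝓝 (inner ℝ x₀ z)) := by
  have hne : (atTop ⊓ 𝓟 {n | ‖x n‖ ≤ M}).NeBot := frequently_iff_neBot.1 hx
  -- The ultrafilter refines `atTop` and contains the indices where the bound holds. It replaces a
  -- weakly convergent subsequence; Banach–Alaoglu, transported by the Riesz isometry, then gives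
  -- the limit.
  let F : Ultrafilter ℕ := Ultrafilter.of (atTop ⊓ 𝓟 {n | ‖x n‖ ≤ M})
  have hF : (F : Filter ℕ) ≤ atTop ⊓ 𝓟 {n | ‖x n‖ ≤ M} := Ultrafilter.of_le _
  let ℓ : ℕ → WeakDual ℝ H := fun n =>
    WeakDual.toStrongDual.symm (InnerProductSpace.toDual ℝ H (x n))
  have hK := WeakDual.isCompact_closedBall (𝕜 := ℝ) (0 : StrongDual ℝ H) M
  have hle : (F.map ℓ : Filter (WeakDual ℝ H)) ≤
      𝓟 (WeakDual.toStrongDual ⁻¹' Metric.closedBall (0 : StrongDual ℝ H) M) := by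
    rw [le_principal_iff, Ultrafilter.coe_map, mem_map]
    refine mem_of_superset (hF.trans inf_le_right (mem_principal_self _)) fun n hn => ?_
    have h : ‖InnerProductSpace.toDual ℝ H (x n)‖ ≤ M := by
      rw [LinearIsometryEquiv.norm_map]; exact hn
    simpa [ℓ] using h
  obtain ⟨ℓ₀, -, hℓ₀⟩ := hK.ultrafilter_le_nhds (F.map ℓ) hle
  refine ⟨F, (InnerProductSpace.toDual ℝ H).symm (WeakDual.toStrongDual ℓ₀),
    hF.trans inf_le_left, hF.trans inf_le_right (mem_principal_self _), fun z => ?_⟩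
  rw [InnerProductSpace.toDual_symm_apply]
  exact ((WeakDual.eval_continuous z).tendsto ℓ₀).comp (tendsto_map'_iff.1 hℓ₀)

/-- If the Galerkin operators of a bounded operator are injective, then the approximate solutions
diverge for every right-hand side outside the range. -/
theorem tendsto_norm_moorePenroseInverse_atTop [CompleteSpace H] (A : H →L[ℝ] H)
    (U : ℕ → Submodule ℝ H) [∀ n, FiniteDimensional ℝ (U n)] (hU : Monotone U)
    (hdense : ⊤ ≤ (⨆ n, U n).topologicalClosure) (T : ∀ n, U n →L[ℝ] U n)
    (hT : ∀ n, T n = (U n).orthogonalProjectionOnto.comp (A.comp (U n).subtypeL))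
    (hinj : ∀ n, Function.Injective (T n)) {y : H} (hy : y ∉ Set.range A) :
    Tendsto (fun n => ‖moorePenroseInverse (T n) ((U n).orthogonalProjectionOnto y)‖)
      atTop atTop := by
  by_contra hcon
  obtain ⟨M, hM⟩ : ∃ M : ℝ, ∃ᶠ n in atTop,
      ‖moorePenroseInverse (T n) ((U n).orthogonalProjectionOnto y)‖ ≤ M := by
    rw [tendsto_atTop] at hcon
    push Not at hcon
    obtain ⟨M, hM⟩ := hcon
    exact ⟨M, hM.mono fun n hn => hn.le⟩
  let x : ℕ → H := fun n => ↑(moorePenroseInverse (T n) ((U n).orthogonalProjectionOnto y))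
  have hM' : ∃ᶠ n in atTop, ‖x n‖ ≤ M := hM
  obtain ⟨F, x₀, hF, hbd, hlim⟩ := exists_ultrafilter_weak_limit hM'
  refine hy ⟨x₀, ext_inner_right ℝ fun z => ?_⟩
  have hproj : Tendsto (fun n => (U n).starProjection z) F (𝓝 z) :=
    (Submodule.starProjection_tendsto_self U hU z hdense).mono_left hF
  -- Galerkin equations: in finite dimension injectivity gives surjectivity, so the least squares
  -- solution is exact, and `A x_n - y` is orthogonal to `U n`.
  have hgal : ∀ n, inner ℝ (A (x n)) ((U n).starProjection z) =
      inner ℝ y ((U n).starProjection z) := by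
    intro n
    have h := apply_moorePenroseInverse (T n)
      ((LinearMap.injective_iff_surjective (f := (T n).toLinearMap)).1 (hinj n))
      ((U n).orthogonalProjectionOnto y)
    have h2 : (U n).starProjection (A (x n)) = (U n).starProjection y := by
      rw [Submodule.starProjection_apply, Submodule.starProjection_apply, ← h,
        show ∀ w : U n, T n w = (U n).orthogonalProjectionOnto (A w) from
          fun w => by rw [hT n]; rfl]
    have h5 : ∀ w : H, inner ℝ w ((U n).starProjection z) =
        inner ℝ ((U n).starProjection w) z := fun w =>
      (Submodule.inner_starProjection_left_eq_right (U n) w z).symm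
    rw [h5, h5, h2]
  have h1 : Tendsto (fun n => inner ℝ y ((U n).starProjection z)) F (𝓝 (inner ℝ y z)) :=
    tendsto_const_nhds.inner hproj
  -- Bounded times strongly null: `A* P_n z → A* z` in norm while `‖x_n‖ ≤ M`. The remaining term
  -- `⟨x_n, A* z⟩` converges by weak convergence.
  have h2 : Tendsto (fun n => inner ℝ (x n) (A.adjoint ((U n).starProjection z) - A.adjoint z)) F
      (𝓝 0) := by
    have h3 : Tendsto (fun n => M * ‖A.adjoint ((U n).starProjection z) - A.adjoint z‖) F
        (𝓝 0) := by
      have h4 := (((A.adjoint.continuous.tendsto z).comp hproj).sub_const (A.adjoint z)).norm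
      simpa using h4.const_mul M
    refine squeeze_zero_norm' ?_ h3
    filter_upwards [hbd] with n hn
    exact (norm_inner_le_norm _ _).trans (by gcongr)
  have h3 : Tendsto (fun n => inner ℝ (A (x n)) ((U n).starProjection z)) F
      (𝓝 (inner ℝ (A x₀) z)) := by
    have h4 := (hlim (A.adjoint z)).add h2
    rw [add_zero, ContinuousLinearMap.adjoint_inner_right] at h4
    refine h4.congr fun n => ?_
    rw [← inner_add_right, add_sub_cancel, ContinuousLinearMap.adjoint_inner_right]
  simp only [hgal] at h3
  exact tendsto_nhds_unique h3 h1

end Divergence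

/-! ### Completeness of the trigonometric system -/

theorem inner_toLp_eq_integral (f : L2) {g : ℝ → ℝ} (hg : MemLp g 2 mu) :
    inner ℝ f (hg.toLp g) = ∫ x in (0 : ℝ)..(2 * Real.pi), f x * g x := by
  rw [L2.inner_def, ← integral_mu]
  refine integral_congr_ae ?_
  filter_upwards [hg.coeFn_toLp] with x hx
  rw [hx]
  simp [mul_comm]

theorem constVec_mem_trigSpace (n : ℕ) : constVec ∈ trigSpace n :=
  Submodule.subset_span (Or.inl (Or.inl rfl))

theorem cosVec_mem_trigSpace {k n : ℕ} (hk : k ∈ Icc 1 n) : cosVec k ∈ trigSpace n :=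
  Submodule.subset_span (Or.inl (Or.inr ⟨k, hk, rfl⟩))

theorem sinVec_mem_trigSpace {k n : ℕ} (hk : k ∈ Icc 1 n) : sinVec k ∈ trigSpace n :=
  Submodule.subset_span (Or.inr ⟨k, hk, rfl⟩)

theorem trigSpace_mono : Monotone trigSpace := by
  intro m n hmn
  have h : Icc 1 m ⊆ Icc 1 n := Icc_subset_Icc_right hmn
  exact Submodule.span_mono (union_subset_union (union_subset_union_right _ (image_mono h))
    (image_mono h))

theorem integral_mul_cos_eq_zero {f : L2} {n k : ℕ} (hf : f ∈ (trigSpace n)ᗮ) (hk : k ≤ n) :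
    ∫ x in (0 : ℝ)..(2 * Real.pi), f x * Real.cos (k * x) = 0 := by
  rcases Nat.eq_zero_or_pos k with rfl | hk0
  · have h := Submodule.inner_left_of_mem_orthogonal (constVec_mem_trigSpace n) hf
    rw [constVec, inner_toLp_eq_integral, intervalIntegral.integral_mul_const] at h
    have h2 := (mul_eq_zero.1 h).resolve_right (by positivity)
    simpa using h2
  · have h := Submodule.inner_left_of_mem_orthogonal (cosVec_mem_trigSpace ⟨hk0, hk⟩) hf
    rw [cosVec, inner_toLp_eq_integral] at h
    simp only [← mul_div_assoc] at h
    rw [intervalIntegral.integral_div] at h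
    exact (div_eq_zero_iff.1 h).resolve_right (by positivity)

theorem integral_mul_sin_eq_zero {f : L2} {n k : ℕ} (hf : f ∈ (trigSpace n)ᗮ) (hk : k ≤ n) :
    ∫ x in (0 : ℝ)..(2 * Real.pi), f x * Real.sin (k * x) = 0 := by
  rcases Nat.eq_zero_or_pos k with rfl | hk0
  · simp
  · have h := Submodule.inner_left_of_mem_orthogonal (sinVec_mem_trigSpace ⟨hk0, hk⟩) hf
    rw [sinVec, inner_toLp_eq_integral] at h
    simp only [← mul_div_assoc] at h
    rw [intervalIntegral.integral_div] at h
    exact (div_eq_zero_iff.1 h).resolve_right (by positivity)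

/-- Vanishing real moments of all orders make every complex Fourier coefficient vanish, and Parseval
then gives zero norm. -/
theorem eq_zero_of_forall_mem_trigSpace_orthogonal {f : L2} (hf : ∀ n, f ∈ (trigSpace n)ᗮ) :
    f = 0 := by
  have hpi : (0 : ℝ) < 2 * Real.pi := by positivity
  have hI := intervalIntegrable_of_memLp (Lp.memLp f)
  have hcos : ∀ m : ℤ, ∫ x in (0 : ℝ)..(2 * Real.pi), f x * Real.cos (m * x) = 0 := by
    intro m
    have h := integral_mul_cos_eq_zero (hf m.natAbs) le_rfl
    rcases Int.natAbs_eq m with hm | hm <;> rw [hm] <;> simpa using h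
  have hsin : ∀ m : ℤ, ∫ x in (0 : ℝ)..(2 * Real.pi), f x * Real.sin (m * x) = 0 := by
    intro m
    have h := integral_mul_sin_eq_zero (hf m.natAbs) le_rfl
    rcases Int.natAbs_eq m with hm | hm <;> rw [hm] <;> simpa using h
  have hofReal : ∀ g : ℝ → ℝ, Continuous g → IntervalIntegrable
      (fun x => ((f x * g x : ℝ) : ℂ)) volume 0 (2 * Real.pi) := fun g hg =>
    have h := hI.mul_continuousOn hg.continuousOn
    ⟨h.1.ofReal, h.2.ofReal⟩
  have hcoef : ∀ m : ℤ, fourierCoeffOn hpi (fun x => (f x : ℂ)) m = 0 := by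
    intro m
    rw [fourierCoeffOn_eq_integral]
    have h1 : ∀ x : ℝ, fourier (-m) (x : AddCircle (2 * Real.pi - 0)) • (f x : ℂ) =
        ((f x * Real.cos (m * x) : ℝ) : ℂ) - ((f x * Real.sin (m * x) : ℝ) : ℂ) * Complex.I := by
      intro x
      rw [fourier_coe_apply]
      have h2 : 2 * (Real.pi : ℂ) * Complex.I * ((-m : ℤ) : ℂ) * x / ((2 * Real.pi - 0 : ℝ) : ℂ) =
          ((-(m * x) : ℝ) : ℂ) * Complex.I := by
        have : (Real.pi : ℂ) ≠ 0 := by exact_mod_cast Real.pi_ne_zero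
        push_cast
        field_simp
        ring
      rw [h2, Complex.exp_mul_I, ← Complex.ofReal_cos, ← Complex.ofReal_sin, Real.cos_neg,
        Real.sin_neg, smul_eq_mul]
      push_cast
      ring
    simp only [h1]
    rw [intervalIntegral.integral_sub, intervalIntegral.integral_mul_const,
      intervalIntegral.integral_ofReal, intervalIntegral.integral_ofReal, hcos, hsin]
    · simp
    · exact hofReal (fun x => Real.cos (m * x)) (by fun_prop)
    · exact (hofReal (fun x => Real.sin (m * x)) (by fun_prop)).mul_const _
  -- Parseval is stated on the half-open interval, which differs from the open one by a null set.
  have hL2 : MemLp (fun x => (f x : ℂ)) 2 (volume.restrict (Ioc 0 (2 * Real.pi))) := by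
    rw [← Measure.restrict_congr_set Ioo_ae_eq_Ioc]
    exact (Lp.memLp f).ofReal
  have hP := hasSum_sq_fourierCoeffOn hpi hL2
  simp only [hcoef, norm_zero, ne_eq, OfNat.ofNat_ne_zero, not_false_eq_true, zero_pow] at hP
  have h0 := hP.unique hasSum_zero
  rw [smul_eq_mul, sub_zero, mul_eq_zero, or_iff_right (by positivity), ← integral_mu] at h0
  have h1 : inner ℝ f f = 0 := by
    rw [L2.inner_def, ← h0]
    refine integral_congr_ae (Eventually.of_forall fun x => ?_)
    simp [Complex.norm_real, pow_two]
  exact inner_self_eq_zero.1 h1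

theorem top_le_topologicalClosure_iSup_trigSpace :
    ⊤ ≤ (⨆ n, trigSpace n).topologicalClosure := by
  refine (Submodule.topologicalClosure_eq_top_iff.2 ?_).ge
  rw [eq_bot_iff]
  intro f hf
  refine (Submodule.mem_bot ℝ).2 (eq_zero_of_forall_mem_trigSpace_orthogonal fun n => ?_)
  exact Submodule.orthogonal_le (le_iSup trigSpace n) hf

/-! ### Orthogonality relations and the Dirichlet kernel -/

section Dirichlet

theorem integral_cos_int_mul (j : ℤ) :
    ∫ x in (0 : ℝ)..(2 * Real.pi), Real.cos (j * x) = if j = 0 then 2 * Real.pi else 0 := by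
  split_ifs with hj
  · simp [hj]
  · have hj' : (j : ℝ) ≠ 0 := by exact_mod_cast hj
    have h := Real.sin_int_mul_pi (2 * j)
    push_cast at h
    rw [intervalIntegral.integral_comp_mul_left (fun x => Real.cos x) hj', integral_cos,
      show (j : ℝ) * (2 * Real.pi) = 2 * j * Real.pi by ring, h]
    simp

theorem integral_sin_int_mul (j : ℤ) :
    ∫ x in (0 : ℝ)..(2 * Real.pi), Real.sin (j * x) = 0 := by
  by_cases hj : j = 0
  · simp [hj]
  · have hj' : (j : ℝ) ≠ 0 := by exact_mod_cast hj
    rw [intervalIntegral.integral_comp_mul_left (fun x => Real.sin x) hj', integral_sin,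
      Real.cos_int_mul_two_pi]
    simp

/-- Product-to-sum. The bound on `k` keeps `k + m` nonzero; at `k = m = 0` the integral would be
`2π`. -/
theorem integral_cos_mul_cos {k : ℕ} (hk : 1 ≤ k) (m : ℕ) :
    ∫ x in (0 : ℝ)..(2 * Real.pi), Real.cos (k * x) * Real.cos (m * x) =
      if k = m then Real.pi else 0 := by
  have h : ∀ x : ℝ, Real.cos (k * x) * Real.cos (m * x) =
      (Real.cos (((k + m : ℕ) : ℤ) * x) + Real.cos (((k : ℤ) - m : ℤ) * x)) / 2 := by
    intro x
    push_cast
    rw [add_mul, sub_mul, Real.cos_add, Real.cos_sub]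
    ring
  simp only [h]
  rw [intervalIntegral.integral_div, intervalIntegral.integral_add
    (Continuous.intervalIntegrable (by fun_prop) _ _)
    (Continuous.intervalIntegrable (by fun_prop) _ _), integral_cos_int_mul, integral_cos_int_mul,
    if_neg (by omega)]
  by_cases hkm : k = m
  · simp [hkm]
  · rw [if_neg hkm, if_neg (by omega)]
    simp

theorem integral_cos_mul_sin (k m : ℕ) :
    ∫ x in (0 : ℝ)..(2 * Real.pi), Real.cos (k * x) * Real.sin (m * x) = 0 := by
  have h : ∀ x : ℝ, Real.cos (k * x) * Real.sin (m * x) =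
      (Real.sin (((k + m : ℕ) : ℤ) * x) - Real.sin (((k : ℤ) - m : ℤ) * x)) / 2 := by
    intro x
    push_cast
    rw [add_mul, sub_mul, Real.sin_add, Real.sin_sub]
    ring
  simp only [h]
  rw [intervalIntegral.integral_div, intervalIntegral.integral_sub
    (Continuous.intervalIntegrable (by fun_prop) _ _)
    (Continuous.intervalIntegrable (by fun_prop) _ _), integral_sin_int_mul, integral_sin_int_mul]
  simp

/-- The normalized Dirichlet kernel. -/
def dirichlet (n : ℕ) (x : ℝ) : ℝ :=
  1 / Real.pi * (1 / 2 + ∑ k ∈ Finset.Icc 1 n, Real.cos (k * x))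

/-- The first derivative of the Dirichlet kernel. -/
def dirichletDeriv (n : ℕ) (x : ℝ) : ℝ :=
  1 / Real.pi * ∑ k ∈ Finset.Icc 1 n, -(k * Real.sin (k * x))

/-- The second derivative of the Dirichlet kernel. -/
def dirichletDerivTwo (n : ℕ) (x : ℝ) : ℝ :=
  1 / Real.pi * ∑ k ∈ Finset.Icc 1 n, -(k ^ 2 * Real.cos (k * x))

variable (n : ℕ) (x : ℝ)

theorem hasDerivAt_cos_nat_mul (k : ℕ) :
    HasDerivAt (fun x : ℝ => Real.cos (k * x)) (-(k * Real.sin (k * x))) x := by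
  have h := ((hasDerivAt_id x).const_mul (k : ℝ)).cos
  simpa [mul_comm] using h

theorem hasDerivAt_sin_nat_mul (k : ℕ) :
    HasDerivAt (fun x : ℝ => Real.sin (k * x)) (k * Real.cos (k * x)) x := by
  have h := ((hasDerivAt_id x).const_mul (k : ℝ)).sin
  simpa [mul_comm] using h

theorem hasDerivAt_dirichlet : HasDerivAt (dirichlet n) (dirichletDeriv n x) x := by
  refine HasDerivAt.const_mul _ (HasDerivAt.const_add _ ?_)
  exact HasDerivAt.fun_sum fun k _ => hasDerivAt_cos_nat_mul x k

theorem hasDerivAt_dirichletDeriv :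
    HasDerivAt (dirichletDeriv n) (dirichletDerivTwo n x) x := by
  refine HasDerivAt.const_mul _ ?_
  refine HasDerivAt.fun_sum fun k _ => ?_
  exact (((hasDerivAt_sin_nat_mul x k).const_mul (k : ℝ)).neg).congr_deriv (by ring)

theorem continuous_dirichlet : Continuous (dirichlet n) := by
  unfold dirichlet; fun_prop

theorem continuous_dirichletDeriv : Continuous (dirichletDeriv n) := by
  unfold dirichletDeriv; fun_prop

theorem continuous_dirichletDerivTwo : Continuous (dirichletDerivTwo n) := by
  unfold dirichletDerivTwo; fun_prop

theorem dirichlet_zero : dirichlet n 0 = (n + 1 / 2) / Real.pi := by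
  simp [dirichlet]; ring

theorem dirichlet_two_pi : dirichlet n (2 * Real.pi) = (n + 1 / 2) / Real.pi := by
  simp [dirichlet]; ring

theorem dirichletDeriv_zero : dirichletDeriv n 0 = 0 := by
  simp [dirichletDeriv]

theorem sin_nat_mul_two_pi (k : ℕ) : Real.sin (k * (2 * Real.pi)) = 0 := by
  have h := Real.sin_nat_mul_pi (k * 2)
  push_cast at h
  rwa [mul_assoc] at h

theorem dirichletDeriv_two_pi : dirichletDeriv n (2 * Real.pi) = 0 := by
  simp [dirichletDeriv, sin_nat_mul_two_pi]

variable {n}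

/-- With the weights `1/2` and `1/π` the kernel represents evaluation at `0` on `X_n`: all cosine
moments up to `n`, including the constant one, are `1`, and the sine moments are `0`. -/
theorem integral_dirichlet_mul_cos {m : ℕ} (hm : m ≤ n) :
    ∫ x in (0 : ℝ)..(2 * Real.pi), dirichlet n x * Real.cos (m * x) = 1 := by
  have h : ∀ x, dirichlet n x * Real.cos (m * x) = 1 / Real.pi * (1 / 2 * Real.cos ((m : ℤ) * x) +
      ∑ k ∈ Finset.Icc 1 n, Real.cos (k * x) * Real.cos (m * x)) := by
    intro x
    rw [dirichlet, mul_assoc, add_mul, Finset.sum_mul]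
    simp
  simp only [h]
  rw [intervalIntegral.integral_const_mul, intervalIntegral.integral_add
    (Continuous.intervalIntegrable (by fun_prop) _ _)
    (Continuous.intervalIntegrable (by fun_prop) _ _), intervalIntegral.integral_const_mul,
    integral_cos_int_mul, intervalIntegral.integral_finsetSum
    (fun k _ => Continuous.intervalIntegrable (by fun_prop) _ _),
    Finset.sum_congr rfl fun k hk => integral_cos_mul_cos (Finset.mem_Icc.1 hk).1 m,
    Finset.sum_ite_eq']
  have hpi := Real.pi_ne_zero
  rcases Nat.eq_zero_or_pos m with rfl | hm0
  · simp
  · rw [if_neg (by omega), if_pos (Finset.mem_Icc.2 ⟨hm0, hm⟩)]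
    field_simp
    ring

theorem integral_dirichlet_mul_sin (m : ℕ) :
    ∫ x in (0 : ℝ)..(2 * Real.pi), dirichlet n x * Real.sin (m * x) = 0 := by
  have h : ∀ x, dirichlet n x * Real.sin (m * x) = 1 / Real.pi * (1 / 2 * Real.sin ((m : ℤ) * x) +
      ∑ k ∈ Finset.Icc 1 n, Real.cos (k * x) * Real.sin (m * x)) := by
    intro x
    rw [dirichlet, mul_assoc, add_mul, Finset.sum_mul]
    simp
  simp only [h]
  rw [intervalIntegral.integral_const_mul, intervalIntegral.integral_add
    (Continuous.intervalIntegrable (by fun_prop) _ _)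
    (Continuous.intervalIntegrable (by fun_prop) _ _), intervalIntegral.integral_const_mul,
    integral_sin_int_mul, intervalIntegral.integral_finsetSum
    (fun k _ => Continuous.intervalIntegrable (by fun_prop) _ _),
    Finset.sum_congr rfl fun k _ => integral_cos_mul_sin k m]
  simp

/-! ### Trigonometric moments of derivatives -/

/-- Since `cos 2πk = 1`, each cosine step leaves the endpoint value of the primitive. The sine
analogue leaves nothing, so iterating produces polynomials in `k`. -/
theorem integral_mul_cos_eq_primitive {f : ℝ → ℝ}
    (hf : IntervalIntegrable f volume 0 (2 * Real.pi)) (k : ℕ) :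
    ∫ x in (0 : ℝ)..(2 * Real.pi), f x * Real.cos (k * x) =
      (∫ x in (0 : ℝ)..(2 * Real.pi), f x) +
      k * ∫ x in (0 : ℝ)..(2 * Real.pi), (∫ t in (0 : ℝ)..x, f t) * Real.sin (k * x) := by
  have h := integral_mul_eq_primitive hf (fun x => hasDerivAt_cos_nat_mul x k) (by fun_prop)
  simp only [mul_comm (f _)]
  rw [h, Real.cos_nat_mul_two_pi, one_mul, ← intervalIntegral.integral_const_mul,
    sub_eq_add_neg, ← intervalIntegral.integral_neg]
  congr 1
  exact intervalIntegral.integral_congr fun x _ => by ring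

theorem integral_mul_sin_eq_primitive {f : ℝ → ℝ}
    (hf : IntervalIntegrable f volume 0 (2 * Real.pi)) (k : ℕ) :
    ∫ x in (0 : ℝ)..(2 * Real.pi), f x * Real.sin (k * x) =
      -(k * ∫ x in (0 : ℝ)..(2 * Real.pi), (∫ t in (0 : ℝ)..x, f t) * Real.cos (k * x)) := by
  have h := integral_mul_eq_primitive hf (fun x => hasDerivAt_sin_nat_mul x k) (by fun_prop)
  simp only [mul_comm (f _)]
  rw [h, sin_nat_mul_two_pi, zero_mul, zero_sub, ← intervalIntegral.integral_const_mul]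
  congr 1
  exact intervalIntegral.integral_congr fun x _ => by ring

theorem integral_deriv_mul_cos {g g' : ℝ → ℝ} (hg : ∀ x, HasDerivAt g (g' x) x)
    (hg' : Continuous g') (hper : g (2 * Real.pi) = g 0) (k : ℕ) :
    ∫ x in (0 : ℝ)..(2 * Real.pi), g' x * Real.cos (k * x) =
      k * ∫ x in (0 : ℝ)..(2 * Real.pi), g x * Real.sin (k * x) := by
  have h := intervalIntegral.integral_mul_deriv_eq_deriv_mul
    (fun x _ => hasDerivAt_cos_nat_mul x k) (fun x _ => hg x)
    (Continuous.intervalIntegrable (by fun_prop) 0 (2 * Real.pi)) (hg'.intervalIntegrable _ _)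
  simp only [mul_comm (g' _)]
  rw [h, Real.cos_nat_mul_two_pi, hper, ← intervalIntegral.integral_const_mul]
  simp only [mul_zero, Real.cos_zero, sub_self, zero_sub]
  rw [← intervalIntegral.integral_neg]
  exact intervalIntegral.integral_congr fun x _ => by ring

theorem integral_deriv_mul_sin {g g' : ℝ → ℝ} (hg : ∀ x, HasDerivAt g (g' x) x)
    (hg' : Continuous g') (k : ℕ) :
    ∫ x in (0 : ℝ)..(2 * Real.pi), g' x * Real.sin (k * x) =
      -(k * ∫ x in (0 : ℝ)..(2 * Real.pi), g x * Real.cos (k * x)) := by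
  have h := intervalIntegral.integral_mul_deriv_eq_deriv_mul
    (fun x _ => hasDerivAt_sin_nat_mul x k) (fun x _ => hg x)
    (Continuous.intervalIntegrable (by fun_prop) 0 (2 * Real.pi)) (hg'.intervalIntegrable _ _)
  simp only [mul_comm (g' _)]
  rw [h, sin_nat_mul_two_pi, ← intervalIntegral.integral_const_mul]
  simp only [mul_zero, Real.sin_zero, zero_mul, sub_self, zero_sub]
  congr 1
  exact intervalIntegral.integral_congr fun x _ => by ring

/-- The combination of derivatives of the Dirichlet kernel with given boundary data. -/
def dirichletComb (n : ℕ) (a b c : ℝ) (x : ℝ) : ℝ :=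
  a * dirichlet n x + b * dirichletDeriv n x + c * dirichletDerivTwo n x

theorem continuous_dirichletComb (a b c : ℝ) : Continuous (dirichletComb n a b c) := by
  have h0 := continuous_dirichlet n
  have h1 := continuous_dirichletDeriv n
  have h2 := continuous_dirichletDerivTwo n
  unfold dirichletComb; fun_prop

theorem integral_dirichletComb_mul (a b c : ℝ) {g : ℝ → ℝ} (hg : Continuous g) :
    ∫ x in (0 : ℝ)..(2 * Real.pi), dirichletComb n a b c x * g x =
      a * (∫ x in (0 : ℝ)..(2 * Real.pi), dirichlet n x * g x) +
      b * (∫ x in (0 : ℝ)..(2 * Real.pi), dirichletDeriv n x * g x) +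
      c * ∫ x in (0 : ℝ)..(2 * Real.pi), dirichletDerivTwo n x * g x := by
  have h0 := continuous_dirichlet n
  have h1 := continuous_dirichletDeriv n
  have h2 := continuous_dirichletDerivTwo n
  simp only [dirichletComb, add_mul, mul_assoc]
  rw [intervalIntegral.integral_add, intervalIntegral.integral_add]
  · simp only [intervalIntegral.integral_const_mul]
  all_goals exact Continuous.intervalIntegrable (by fun_prop) _ _

/-- Each derivative moves a factor `m` onto the moments: the kernel contributes `1` to the cosine,
its first derivative `-m` to the sine, its second `-m²` to the cosine. These are the patterns that
arise for `p ≤ 3`. -/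
theorem integral_dirichletComb_mul_cos (a b c : ℝ) {m : ℕ} (hm : m ≤ n) :
    ∫ x in (0 : ℝ)..(2 * Real.pi), dirichletComb n a b c x * Real.cos (m * x) =
      a - m ^ 2 * c := by
  rw [integral_dirichletComb_mul a b c (by fun_prop), integral_dirichlet_mul_cos hm,
    integral_deriv_mul_cos (hasDerivAt_dirichlet n) (continuous_dirichletDeriv n)
      (by rw [dirichlet_zero, dirichlet_two_pi]), integral_dirichlet_mul_sin,
    integral_deriv_mul_cos (hasDerivAt_dirichletDeriv n) (continuous_dirichletDerivTwo n)
      (by rw [dirichletDeriv_zero, dirichletDeriv_two_pi]),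
    integral_deriv_mul_sin (hasDerivAt_dirichlet n) (continuous_dirichletDeriv n),
    integral_dirichlet_mul_cos hm]
  ring

theorem integral_dirichletComb_mul_sin (a b c : ℝ) {m : ℕ} (hm : m ≤ n) :
    ∫ x in (0 : ℝ)..(2 * Real.pi), dirichletComb n a b c x * Real.sin (m * x) =
      -(m * b) := by
  rw [integral_dirichletComb_mul a b c (by fun_prop), integral_dirichlet_mul_sin,
    integral_deriv_mul_sin (hasDerivAt_dirichlet n) (continuous_dirichletDeriv n),
    integral_dirichlet_mul_cos hm,
    integral_deriv_mul_sin (hasDerivAt_dirichletDeriv n) (continuous_dirichletDerivTwo n),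
    integral_deriv_mul_cos (hasDerivAt_dirichlet n) (continuous_dirichletDeriv n)
      (by rw [dirichlet_zero, dirichlet_two_pi]), integral_dirichlet_mul_sin]
  ring

end Dirichlet

/-! ### Trigonometric polynomials in `trigSpace` -/

/-- The functions whose class belongs to `trigSpace n`. -/
def IsTrig (n : ℕ) (g : ℝ → ℝ) : Prop :=
  ∃ h : MemLp g 2 mu, h.toLp g ∈ trigSpace n

namespace IsTrig

variable {n : ℕ} {g h : ℝ → ℝ}

theorem add (hg : IsTrig n g) (hh : IsTrig n h) : IsTrig n (fun x => g x + h x) :=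
  ⟨hg.1.add hh.1, by
    have h := (trigSpace n).add_mem hg.2 hh.2
    rwa [← MemLp.toLp_add] at h⟩

theorem const_mul (c : ℝ) (hg : IsTrig n g) : IsTrig n (fun x => c * g x) :=
  ⟨hg.1.const_smul c, by
    have h := (trigSpace n).smul_mem c hg.2
    rwa [← MemLp.toLp_const_smul] at h⟩

theorem const (c : ℝ) : IsTrig n (fun _ => c) := by
  have h : IsTrig n (fun _ => 1 / √(2 * Real.pi)) := ⟨_, constVec_mem_trigSpace n⟩
  have h2 := h.const_mul (c * √(2 * Real.pi))
  have h3 : √(2 * Real.pi) ≠ 0 := by positivity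
  rwa [show c * √(2 * Real.pi) * (1 / √(2 * Real.pi)) = c by field_simp] at h2

theorem cos {k : ℕ} (hk : k ∈ Finset.Icc 1 n) : IsTrig n (fun x => Real.cos (k * x)) := by
  have h : IsTrig n (fun x => Real.cos (k * x) / √Real.pi) :=
    ⟨_, cosVec_mem_trigSpace (Finset.mem_Icc.1 hk)⟩
  have h2 := h.const_mul √Real.pi
  have h3 : √Real.pi ≠ 0 := by positivity
  simpa only [mul_div_cancel₀ _ h3] using h2

theorem sin {k : ℕ} (hk : k ∈ Finset.Icc 1 n) : IsTrig n (fun x => Real.sin (k * x)) := by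
  have h : IsTrig n (fun x => Real.sin (k * x) / √Real.pi) :=
    ⟨_, sinVec_mem_trigSpace (Finset.mem_Icc.1 hk)⟩
  have h2 := h.const_mul √Real.pi
  have h3 : √Real.pi ≠ 0 := by positivity
  simpa only [mul_div_cancel₀ _ h3] using h2

theorem sum {ι : Type*} {s : Finset ι} {g : ι → ℝ → ℝ} (hg : ∀ i ∈ s, IsTrig n (g i)) :
    IsTrig n (fun x => ∑ i ∈ s, g i x) := by
  classical
  induction s using Finset.induction_on with
  | empty => simpa using const 0
  | insert i s hi ih =>
    simp only [Finset.sum_insert hi]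
    exact (hg i (Finset.mem_insert_self _ _)).add
      (ih fun j hj => hg j (Finset.mem_insert_of_mem hj))

theorem dirichletComb (a b c : ℝ) : IsTrig n (dirichletComb n a b c) := by
  have h0 : IsTrig n (dirichlet n) := ((const _).add (sum fun k hk => cos hk)).const_mul _
  have h1 : IsTrig n (dirichletDeriv n) :=
    (sum fun k hk => by simpa using ((sin hk).const_mul k).const_mul (-1)).const_mul _
  have h2 : IsTrig n (dirichletDerivTwo n) :=
    (sum fun k hk => by simpa using ((cos hk).const_mul (k ^ 2)).const_mul (-1)).const_mul _
  exact ((h0.const_mul a).add (h1.const_mul b)).add (h2.const_mul c)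

end IsTrig

/-- An element of `trigSpace n` is determined by its trigonometric moments. -/
theorem ae_eq_of_moments {n : ℕ} {φ : L2} (hφ : φ ∈ trigSpace n) {g : ℝ → ℝ} (hg : IsTrig n g)
    (hcos : ∀ k ≤ n, ∫ x in (0 : ℝ)..(2 * Real.pi), φ x * Real.cos (k * x) =
      ∫ x in (0 : ℝ)..(2 * Real.pi), g x * Real.cos (k * x))
    (hsin : ∀ k ≤ n, ∫ x in (0 : ℝ)..(2 * Real.pi), φ x * Real.sin (k * x) =
      ∫ x in (0 : ℝ)..(2 * Real.pi), g x * Real.sin (k * x)) :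
    φ =ᵐ[mu] g := by
  obtain ⟨hgm, hgt⟩ := hg
  have hcongr : ∀ q : ℝ → ℝ, ∫ x in (0 : ℝ)..(2 * Real.pi), hgm.toLp g x * q x =
      ∫ x in (0 : ℝ)..(2 * Real.pi), g x * q x := by
    intro q
    rw [← integral_mu, ← integral_mu]
    exact integral_congr_ae (hgm.coeFn_toLp.mono fun x hx => by simp only [hx])
  -- The difference lies in `trigSpace n` and is orthogonal to it, so it is zero.
  have horth : φ - hgm.toLp g ∈ (trigSpace n)ᗮ := by
    rw [trigSpace, Submodule.mem_orthogonal']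
    intro w hw
    induction hw using Submodule.span_induction with
    | zero => simp
    | add x y _ _ hx hy => rw [inner_add_right, hx, hy, add_zero]
    | smul c x _ hx => rw [inner_smul_right, hx, mul_zero]
    | mem w hw =>
      rw [inner_sub_left, sub_eq_zero]
      rcases hw with (rfl | ⟨k, hk, rfl⟩) | ⟨k, hk, rfl⟩
      · rw [constVec, inner_toLp_eq_integral, inner_toLp_eq_integral, hcongr]
        have h := hcos 0 n.zero_le
        simp only [Nat.cast_zero, zero_mul, Real.cos_zero, mul_one] at h
        rw [intervalIntegral.integral_mul_const, intervalIntegral.integral_mul_const, h]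
      · rw [cosVec, inner_toLp_eq_integral, inner_toLp_eq_integral, hcongr]
        simp only [← mul_div_assoc]
        rw [intervalIntegral.integral_div, intervalIntegral.integral_div, hcos k hk.2]
      · rw [sinVec, inner_toLp_eq_integral, inner_toLp_eq_integral, hcongr]
        simp only [← mul_div_assoc]
        rw [intervalIntegral.integral_div, intervalIntegral.integral_div, hsin k hk.2]
  have h0 : φ - hgm.toLp g = 0 := by
    have h := Submodule.inner_right_of_mem_orthogonal ((trigSpace n).sub_mem hφ hgt) horth
    exact inner_self_eq_zero.1 h
  have h1 : φ = hgm.toLp g := sub_eq_zero.1 h0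
  rw [h1]
  exact hgm.coeFn_toLp

/-! ### Injectivity of the Galerkin operators -/

/-- The primitive of a function vanishing at `0`. -/
def primitive (f : ℝ → ℝ) (x : ℝ) : ℝ := ∫ t in (0 : ℝ)..x, f t

theorem integralFun_eq_iterate {p : ℕ} {f : ℝ → ℝ} {x : ℝ} (hp : 1 ≤ p) (hx : 0 ≤ x)
    (hf : IntervalIntegrable f volume 0 x) : integralFun p f x = primitive^[p] f x := by
  induction p, hp using Nat.le_induction generalizing x with
  | base => exact integralFun_one
  | succ p hp ih =>
    rw [integralFun_succ hp hx hf, Function.iterate_succ_apply', primitive]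
    refine intervalIntegral.integral_congr fun t ht => ?_
    rw [uIcc_of_le hx] at ht
    exact ih ht.1 (intervalIntegrable_mono_Icc hf ht)

theorem intervalIntegrable_primitive {f : ℝ → ℝ}
    (hf : IntervalIntegrable f volume 0 (2 * Real.pi)) :
    IntervalIntegrable (primitive f) volume 0 (2 * Real.pi) :=
  (continuousOn_primitive_Icc hf two_pi_nonneg).intervalIntegrable_of_Icc two_pi_nonneg

theorem opA_coeFn_eq_iterate {p : ℕ} (hp : 1 ≤ p) (φ : L2) :
    opA p φ =ᵐ[mu] primitive^[p] φ := by
  filter_upwards [opA_coeFn p φ, ae_restrict_mem measurableSet_Ioo] with x h hx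
  rw [h, integralFun_eq_iterate hp hx.1.le (intervalIntegrable_mono_Icc
    (intervalIntegrable_of_memLp (Lp.memLp φ)) (Ioo_subset_Icc_self hx))]

/-! ### Vanishing moments of the `p`-fold primitive -/

section Moments

variable {p n k : ℕ} {φ : L2}

theorem integral_iterate_mul_cos_eq_zero (hp : 1 ≤ p) (hφ : opA p φ ∈ (trigSpace n)ᗮ)
    (hk : k ≤ n) :
    ∫ x in (0 : ℝ)..(2 * Real.pi), primitive^[p] φ x * Real.cos (k * x) = 0 := by
  have h := integral_mul_cos_eq_zero hφ hk
  rw [← integral_mu] at h ⊢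
  rw [← h]
  exact integral_congr_ae ((opA_coeFn_eq_iterate hp φ).mono fun x hx => by simp only [hx])

theorem integral_iterate_mul_sin_eq_zero (hp : 1 ≤ p) (hφ : opA p φ ∈ (trigSpace n)ᗮ)
    (hk : k ≤ n) :
    ∫ x in (0 : ℝ)..(2 * Real.pi), primitive^[p] φ x * Real.sin (k * x) = 0 := by
  have h := integral_mul_sin_eq_zero hφ hk
  rw [← integral_mu] at h ⊢
  rw [← h]
  exact integral_congr_ae ((opA_coeFn_eq_iterate hp φ).mono fun x hx => by simp only [hx])

/-- Orthogonality to constants, read as an endpoint condition; it is the equation that closes the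
linear system. -/
theorem primitive_iterate_two_pi_eq_zero (hp : 1 ≤ p) (hφ : opA p φ ∈ (trigSpace n)ᗮ) :
    primitive^[p + 1] φ (2 * Real.pi) = 0 := by
  have h := integral_iterate_mul_cos_eq_zero hp hφ n.zero_le
  simp only [Nat.cast_zero, zero_mul, Real.cos_zero, mul_one] at h
  rw [Function.iterate_succ_apply', primitive, h]

end Moments

/-! ### Explicit primitives of the Dirichlet kernel and their values at `2π` -/

section Explicit

variable (n : ℕ) (x : ℝ)

/-- The partial sum of `∑ 1 / k ^ 2`. -/
def zetaTwoSum : ℝ := ∑ k ∈ Finset.Icc 1 n, 1 / (k : ℝ) ^ 2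

/-- The first primitive of the Dirichlet kernel. -/
def dirichletPrim₁ : ℝ :=
  1 / Real.pi * (x / 2 + ∑ k ∈ Finset.Icc 1 n, Real.sin (k * x) / k)

/-- The second primitive of the Dirichlet kernel. -/
def dirichletPrim₂ : ℝ :=
  1 / Real.pi * (x ^ 2 / 4 + ∑ k ∈ Finset.Icc 1 n, (1 - Real.cos (k * x)) / (k : ℝ) ^ 2)

/-- The third primitive of the Dirichlet kernel. -/
def dirichletPrim₃ : ℝ :=
  1 / Real.pi * (x ^ 3 / 12 +
    ∑ k ∈ Finset.Icc 1 n, (x / (k : ℝ) ^ 2 - Real.sin (k * x) / (k : ℝ) ^ 3))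

/-- The fourth primitive of the Dirichlet kernel. -/
def dirichletPrim₄ : ℝ :=
  1 / Real.pi * (x ^ 4 / 48 + ∑ k ∈ Finset.Icc 1 n,
    (x ^ 2 / (2 * (k : ℝ) ^ 2) + (Real.cos (k * x) - 1) / (k : ℝ) ^ 4))

theorem cast_ne_zero_of_mem_Icc {k : ℕ} (hk : k ∈ Finset.Icc 1 n) : (k : ℝ) ≠ 0 :=
  Nat.cast_ne_zero.2 (Nat.one_le_iff_ne_zero.1 (Finset.mem_Icc.1 hk).1)

theorem hasDerivAt_pow_div (m : ℕ) (c d : ℝ) (h : (m + 1 : ℝ) / c = 1 / d) :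
    HasDerivAt (fun x : ℝ => x ^ (m + 1) / c) (x ^ m / d) x := by
  refine ((hasDerivAt_pow (m + 1) x).div_const c).congr_deriv ?_
  push_cast
  rw [mul_comm, mul_div_assoc, h, mul_one_div]

theorem hasDerivAt_dirichletPrim₁ : HasDerivAt (dirichletPrim₁ n) (dirichlet n x) x := by
  refine HasDerivAt.const_mul _ (HasDerivAt.add ((hasDerivAt_id x).div_const 2) ?_)
  refine HasDerivAt.fun_sum fun k hk => ?_
  have hk0 := cast_ne_zero_of_mem_Icc n hk
  exact ((hasDerivAt_sin_nat_mul x k).div_const (k : ℝ)).congr_deriv (by field_simp)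

theorem hasDerivAt_dirichletPrim₂ : HasDerivAt (dirichletPrim₂ n) (dirichletPrim₁ n x) x := by
  refine HasDerivAt.const_mul _ (HasDerivAt.add ?_ ?_)
  · simpa using hasDerivAt_pow_div x 1 4 2 (by norm_num)
  refine HasDerivAt.fun_sum fun k hk => ?_
  have hk0 := cast_ne_zero_of_mem_Icc n hk
  exact (((hasDerivAt_cos_nat_mul x k).const_sub 1).div_const _).congr_deriv (by field_simp)

theorem hasDerivAt_dirichletPrim₃ : HasDerivAt (dirichletPrim₃ n) (dirichletPrim₂ n x) x := by
  refine HasDerivAt.const_mul _ (HasDerivAt.add ?_ ?_)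
  · exact hasDerivAt_pow_div x 2 12 4 (by norm_num)
  refine HasDerivAt.fun_sum fun k hk => ?_
  have hk0 := cast_ne_zero_of_mem_Icc n hk
  exact (((hasDerivAt_id x).div_const _).sub
    ((hasDerivAt_sin_nat_mul x k).div_const _)).congr_deriv (by field_simp)

theorem hasDerivAt_dirichletPrim₄ : HasDerivAt (dirichletPrim₄ n) (dirichletPrim₃ n x) x := by
  refine HasDerivAt.const_mul _ (HasDerivAt.add ?_ ?_)
  · exact hasDerivAt_pow_div x 3 48 12 (by norm_num)
  refine HasDerivAt.fun_sum fun k hk => ?_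
  have hk0 := cast_ne_zero_of_mem_Icc n hk
  exact (((hasDerivAt_pow 2 x).div_const _).add
    (((hasDerivAt_cos_nat_mul x k).sub_const 1).div_const _)).congr_deriv (by
      push_cast; field_simp; ring)

theorem dirichletPrim₁_zero : dirichletPrim₁ n 0 = 0 := by simp [dirichletPrim₁]

theorem dirichletPrim₂_zero : dirichletPrim₂ n 0 = 0 := by simp [dirichletPrim₂]

theorem dirichletPrim₃_zero : dirichletPrim₃ n 0 = 0 := by simp [dirichletPrim₃]

theorem dirichletPrim₄_zero : dirichletPrim₄ n 0 = 0 := by simp [dirichletPrim₄]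

theorem dirichletPrim₁_two_pi : dirichletPrim₁ n (2 * Real.pi) = 1 := by
  simp [dirichletPrim₁, sin_nat_mul_two_pi, Real.pi_ne_zero]

theorem dirichletPrim₂_two_pi : dirichletPrim₂ n (2 * Real.pi) = Real.pi := by
  simp only [dirichletPrim₂, Real.cos_nat_mul_two_pi, sub_self, zero_div, Finset.sum_const_zero]
  field_simp
  ring

theorem dirichletPrim₃_two_pi :
    dirichletPrim₃ n (2 * Real.pi) = 2 * Real.pi ^ 2 / 3 + 2 * zetaTwoSum n := by
  have h : ∑ k ∈ Finset.Icc 1 n, 2 * Real.pi / (k : ℝ) ^ 2 = 2 * Real.pi * zetaTwoSum n := by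
    rw [zetaTwoSum, Finset.mul_sum]
    exact Finset.sum_congr rfl fun k _ => by ring
  simp only [dirichletPrim₃, sin_nat_mul_two_pi, zero_div, sub_zero, h]
  field_simp
  ring

theorem dirichletPrim₄_two_pi : dirichletPrim₄ n (2 * Real.pi) =
    Real.pi ^ 3 / 3 + 2 * Real.pi * zetaTwoSum n := by
  have h : ∑ k ∈ Finset.Icc 1 n, (2 * Real.pi) ^ 2 / (2 * (k : ℝ) ^ 2) =
      2 * Real.pi ^ 2 * zetaTwoSum n := by
    rw [zetaTwoSum, Finset.mul_sum]
    exact Finset.sum_congr rfl fun k _ => by ring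
  simp only [dirichletPrim₄, Real.cos_nat_mul_two_pi, sub_self, zero_div, add_zero, h]
  field_simp
  ring

/-- A primitive depends only on the almost-everywhere class, so an identity between classes yields
exact values, in particular at the endpoint `2π`. -/
theorem primitive_eq_of_ae_eq {f W W' : ℝ → ℝ} (hf : f =ᵐ[mu] W')
    (hW : ∀ x, HasDerivAt W (W' x) x) (hc : Continuous W') (h0 : W 0 = 0) {x : ℝ}
    (hx : x ∈ Icc 0 (2 * Real.pi)) : primitive f x = W x := by
  have h : ∀ᵐ t, t ∈ Ioc 0 (2 * Real.pi) → f t = W' t := by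
    rw [← ae_restrict_iff' measurableSet_Ioc, ← Measure.restrict_congr_set Ioo_ae_eq_Ioc]
    exact hf
  have h1 : primitive f x = ∫ t in (0 : ℝ)..x, W' t := by
    refine intervalIntegral.integral_congr_ae ?_
    filter_upwards [h] with t ht ht'
    rw [uIoc_of_le hx.1] at ht'
    exact ht ⟨ht'.1, ht'.2.trans hx.2⟩
  rw [h1, intervalIntegral.integral_eq_sub_of_hasDerivAt (fun y _ => hW y)
    (hc.intervalIntegrable _ _), h0, sub_zero]

theorem primitive_ae_eq {f W W' : ℝ → ℝ} (hf : f =ᵐ[mu] W')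
    (hW : ∀ x, HasDerivAt W (W' x) x) (hc : Continuous W') (h0 : W 0 = 0) :
    primitive f =ᵐ[mu] W := by
  filter_upwards [ae_restrict_mem measurableSet_Ioo] with x hx
  exact primitive_eq_of_ae_eq hf hW hc h0 (Ioo_subset_Icc_self hx)

variable {n}

/-- The values at `2π` of the iterated primitives of a combination of derivatives of the Dirichlet
kernel. -/
theorem iterate_primitive_two_pi {f : ℝ → ℝ} {a b c : ℝ} (hf : f =ᵐ[mu] dirichletComb n a b c) :
    primitive^[2] f (2 * Real.pi) = a * Real.pi + b * (1 - (2 * n + 1)) ∧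
    primitive^[3] f (2 * Real.pi) = a * (2 * Real.pi ^ 2 / 3 + 2 * zetaTwoSum n) +
      b * (Real.pi - (2 * n + 1) * Real.pi) + c * (1 - (2 * n + 1)) ∧
    primitive^[4] f (2 * Real.pi) = a * (Real.pi ^ 3 / 3 + 2 * Real.pi * zetaTwoSum n) +
      b * (2 * Real.pi ^ 2 / 3 + 2 * zetaTwoSum n - 2 / 3 * (2 * n + 1) * Real.pi ^ 2) +
      c * (Real.pi - (2 * n + 1) * Real.pi) := by
  -- `N / π` is the value of the kernel at `0` and at `2π`. It is the constant of integration on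
  -- passing from a derivative of the kernel back to the kernel, and later integrations turn it into
  -- the terms `N / π * x ^ j / j!` below.
  obtain ⟨N, hN⟩ : ∃ N : ℝ, N = n + 1 / 2 := ⟨_, rfl⟩
  have hNn : (2 * n + 1 : ℝ) = 2 * N := by rw [hN]; ring
  have hpi := Real.pi_ne_zero
  let W₁ : ℝ → ℝ := fun x => a * dirichletPrim₁ n x + b * (dirichlet n x - N / Real.pi) +
    c * dirichletDeriv n x
  let W₂ : ℝ → ℝ := fun x => a * dirichletPrim₂ n x +
    b * (dirichletPrim₁ n x - N / Real.pi * x) + c * (dirichlet n x - N / Real.pi)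
  let W₃ : ℝ → ℝ := fun x => a * dirichletPrim₃ n x +
    b * (dirichletPrim₂ n x - N / Real.pi * (x ^ 2 / 2)) +
    c * (dirichletPrim₁ n x - N / Real.pi * x)
  let W₄ : ℝ → ℝ := fun x => a * dirichletPrim₄ n x +
    b * (dirichletPrim₃ n x - N / Real.pi * (x ^ 3 / 6)) +
    c * (dirichletPrim₂ n x - N / Real.pi * (x ^ 2 / 2))
  have hd₁ : ∀ x, HasDerivAt W₁ (dirichletComb n a b c x) x := fun x =>
    (((hasDerivAt_dirichletPrim₁ n x).const_mul a).add
      (((hasDerivAt_dirichlet n x).sub_const _).const_mul b)).add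
      ((hasDerivAt_dirichletDeriv n x).const_mul c)
  have hx₁ : ∀ x : ℝ, HasDerivAt (fun x => N / Real.pi * x) (N / Real.pi) x := fun x => by
    simpa using (hasDerivAt_id x).const_mul (N / Real.pi)
  have hx₂ : ∀ x : ℝ, HasDerivAt (fun x => N / Real.pi * (x ^ 2 / 2)) (N / Real.pi * x) x :=
    fun x => by simpa using (hasDerivAt_pow_div x 1 2 1 (by norm_num)).const_mul (N / Real.pi)
  have hx₃ : ∀ x : ℝ, HasDerivAt (fun x => N / Real.pi * (x ^ 3 / 6))
      (N / Real.pi * (x ^ 2 / 2)) x :=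
    fun x => (hasDerivAt_pow_div x 2 6 2 (by norm_num)).const_mul (N / Real.pi)
  have hd₂ : ∀ x, HasDerivAt W₂ (W₁ x) x := fun x =>
    (((hasDerivAt_dirichletPrim₂ n x).const_mul a).add
      (((hasDerivAt_dirichletPrim₁ n x).sub (hx₁ x)).const_mul b)).add
      (((hasDerivAt_dirichlet n x).sub_const _).const_mul c)
  have hd₃ : ∀ x, HasDerivAt W₃ (W₂ x) x := fun x =>
    (((hasDerivAt_dirichletPrim₃ n x).const_mul a).add
      (((hasDerivAt_dirichletPrim₂ n x).sub (hx₂ x)).const_mul b)).add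
      (((hasDerivAt_dirichletPrim₁ n x).sub (hx₁ x)).const_mul c)
  have hd₄ : ∀ x, HasDerivAt W₄ (W₃ x) x := fun x =>
    (((hasDerivAt_dirichletPrim₄ n x).const_mul a).add
      (((hasDerivAt_dirichletPrim₃ n x).sub (hx₃ x)).const_mul b)).add
      (((hasDerivAt_dirichletPrim₂ n x).sub (hx₂ x)).const_mul c)
  have hcont : ∀ {W W' : ℝ → ℝ}, (∀ x, HasDerivAt W (W' x) x) → Continuous W := fun h =>
    continuous_iff_continuousAt.2 fun x => (h x).continuousAt
  have hz₁ : W₁ 0 = 0 := by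
    simp [W₁, dirichletPrim₁_zero, dirichlet_zero, dirichletDeriv_zero, hN]
  have hz₂ : W₂ 0 = 0 := by
    simp [W₂, dirichletPrim₁_zero, dirichletPrim₂_zero, dirichlet_zero, hN]
  have hz₃ : W₃ 0 = 0 := by
    simp [W₃, dirichletPrim₁_zero, dirichletPrim₂_zero, dirichletPrim₃_zero]
  have hz₄ : W₄ 0 = 0 := by
    simp [W₄, dirichletPrim₂_zero, dirichletPrim₃_zero, dirichletPrim₄_zero]
  have h₁ := primitive_ae_eq hf hd₁ (continuous_dirichletComb a b c) hz₁
  have h₂ := primitive_ae_eq h₁ hd₂ (hcont hd₁) hz₂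
  have h₃ := primitive_ae_eq h₂ hd₃ (hcont hd₂) hz₃
  have hmem : 2 * Real.pi ∈ Icc 0 (2 * Real.pi) := right_mem_Icc.2 two_pi_nonneg
  rw [hNn]
  refine ⟨(primitive_eq_of_ae_eq h₁ hd₂ (hcont hd₁) hz₂ hmem).trans ?_,
    (primitive_eq_of_ae_eq h₂ hd₃ (hcont hd₂) hz₃ hmem).trans ?_,
    (primitive_eq_of_ae_eq h₃ hd₄ (hcont hd₃) hz₄ hmem).trans ?_⟩
  · simp only [W₂, dirichletPrim₁_two_pi, dirichletPrim₂_two_pi, dirichlet_two_pi, ← hN]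
    field_simp
    ring
  · simp only [W₃, dirichletPrim₁_two_pi, dirichletPrim₂_two_pi, dirichletPrim₃_two_pi]
    field_simp
  · simp only [W₄, dirichletPrim₂_two_pi, dirichletPrim₃_two_pi, dirichletPrim₄_two_pi]
    field_simp
    ring

/-! ### A bound for the tail of `∑ 1 / k ^ 2` -/

variable (n)

/-- Telescoping: `(m + 1/2)(m + 3/2) = (m + 1)² - 1/4`, so `1/(m + 1)²` is at most `1/(m + 1/2) -
1/(m + 3/2)`. Hence the partial sum plus `1/(m + 1/2)` decreases, with limit `π²/6`. -/
theorem add_half_mul_zetaTwo_tail_le : (n + 1 / 2 : ℝ) * (Real.pi ^ 2 / 6 - zetaTwoSum n) ≤ 1 := by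
  have hanti : Antitone fun m : ℕ => zetaTwoSum m + 1 / (m + 1 / 2 : ℝ) := by
    refine antitone_nat_of_succ_le fun m => ?_
    have h : zetaTwoSum (m + 1) = zetaTwoSum m + 1 / ((m : ℝ) + 1) ^ 2 := by
      rw [zetaTwoSum, Finset.sum_Icc_succ_top (by omega), zetaTwoSum]
      push_cast
      rfl
    rw [h]
    have h2 : 1 / ((m : ℝ) + 1) ^ 2 ≤ 1 / (m + 1 / 2 : ℝ) - 1 / (m + 1 + 1 / 2 : ℝ) := by
      rw [div_sub_div _ _ (by positivity) (by positivity),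
        div_le_div_iff₀ (by positivity) (by positivity)]
      nlinarith
    push_cast
    linarith
  have hsum : Tendsto (fun m : ℕ => zetaTwoSum m) atTop (𝓝 (Real.pi ^ 2 / 6)) := by
    have h := (tendsto_add_atTop_iff_nat 1).2 hasSum_zeta_two.tendsto_sum_nat
    refine h.congr fun m => ?_
    rw [zetaTwoSum, Finset.range_eq_Ico, Finset.sum_eq_sum_Ico_succ_bot (by omega)]
    simp only [Nat.cast_zero, ne_eq, OfNat.ofNat_ne_zero, not_false_eq_true, zero_pow, div_zero,
      zero_add]
    rfl
  have hlim : Tendsto (fun m : ℕ => zetaTwoSum m + 1 / (m + 1 / 2 : ℝ)) atTop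
      (𝓝 (Real.pi ^ 2 / 6 + 0)) := by
    refine hsum.add ?_
    have h : Tendsto (fun m : ℕ => (m + 1 / 2 : ℝ)) atTop atTop :=
      tendsto_atTop_add_const_right _ _ tendsto_natCast_atTop_atTop
    simp only [one_div] at h ⊢
    exact h.inv_tendsto_atTop
  have h := hanti.le_of_tendsto hlim n
  have hN : (0 : ℝ) < n + 1 / 2 := by positivity
  have h3 : Real.pi ^ 2 / 6 - zetaTwoSum n ≤ 1 / (n + 1 / 2 : ℝ) := by
    simp only [add_zero] at h
    linarith
  calc (n + 1 / 2 : ℝ) * (Real.pi ^ 2 / 6 - zetaTwoSum n)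
      ≤ (n + 1 / 2 : ℝ) * (1 / (n + 1 / 2 : ℝ)) := by gcongr
    _ = 1 := by field_simp

end Explicit

/-! ### Solving the linear systems for the endpoint values -/

section Injectivity

variable {n : ℕ} {φ : L2}

theorem eq_zero_of_ae_eq_dirichletComb (h : φ =ᵐ[mu] dirichletComb n 0 0 0) : φ = 0 := by
  refine Lp.ext (h.trans ((Lp.coeFn_zero ℝ 2 mu).symm.mono fun x hx => ?_))
  rw [← hx]
  simp [dirichletComb]

/-- Here `φ` is a multiple `d` of the Dirichlet kernel, whose second primitive at `2π` is `π`; the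
closing condition reads `d π = 0`. -/
theorem eq_zero_of_opA_one_mem_orthogonal (hφ : φ ∈ trigSpace n)
    (h : opA 1 φ ∈ (trigSpace n)ᗮ) : φ = 0 := by
  have hi := intervalIntegrable_of_memLp (Lp.memLp φ)
  have hC := fun k (hk : k ≤ n) => integral_iterate_mul_cos_eq_zero le_rfl h hk
  have hS := fun k (hk : k ≤ n) => integral_iterate_mul_sin_eq_zero le_rfl h hk
  have hf := ae_eq_of_moments hφ (IsTrig.dirichletComb (primitive φ (2 * Real.pi)) 0 0)
    (fun k hk => ?_) (fun k hk => ?_)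
  · have h2 := (iterate_primitive_two_pi hf).1
    have h0 : primitive^[2] φ (2 * Real.pi) = 0 := primitive_iterate_two_pi_eq_zero le_rfl h
    rw [h0, zero_mul, add_zero, eq_comm, mul_eq_zero, or_iff_left Real.pi_ne_zero] at h2
    rw [h2] at hf
    exact eq_zero_of_ae_eq_dirichletComb hf
  · rw [integral_dirichletComb_mul_cos _ _ _ hk, integral_mul_cos_eq_primitive hi]
    refine (congrArg (fun z => _ + (k : ℝ) * z) (hS k hk)).trans ?_
    simp [primitive]
  · rw [integral_dirichletComb_mul_sin _ _ _ hk, integral_mul_sin_eq_primitive hi]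
    refine (congrArg (fun z => -((k : ℝ) * z)) (hC k hk)).trans ?_
    simp

/-- Two unknowns, the endpoint values `d₁`, `d₀` of the first and second primitives, are the
coefficients of the kernel and its derivative; the second and third primitives at `2π` give two
equations. -/
theorem eq_zero_of_opA_two_mem_orthogonal (hφ : φ ∈ trigSpace n)
    (h : opA 2 φ ∈ (trigSpace n)ᗮ) : φ = 0 := by
  have hi := intervalIntegrable_of_memLp (Lp.memLp φ)
  have hi₁ := intervalIntegrable_primitive hi
  have hC := fun k (hk : k ≤ n) => integral_iterate_mul_cos_eq_zero one_le_two h hk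
  have hS := fun k (hk : k ≤ n) => integral_iterate_mul_sin_eq_zero one_le_two h hk
  have hC₁ : ∀ k ≤ n, ∫ x in (0 : ℝ)..(2 * Real.pi), primitive φ x * Real.cos (k * x) =
      primitive^[2] φ (2 * Real.pi) := fun k hk => by
    rw [integral_mul_cos_eq_primitive hi₁]
    refine (congrArg (fun z => _ + (k : ℝ) * z) (hS k hk)).trans ?_
    simp [primitive]
  have hS₁ : ∀ k ≤ n, ∫ x in (0 : ℝ)..(2 * Real.pi), primitive φ x * Real.sin (k * x) = 0 :=
    fun k hk => by
    rw [integral_mul_sin_eq_primitive hi₁]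
    refine (congrArg (fun z => -((k : ℝ) * z)) (hC k hk)).trans ?_
    simp
  have hf := ae_eq_of_moments hφ (IsTrig.dirichletComb (primitive φ (2 * Real.pi))
    (primitive^[2] φ (2 * Real.pi)) 0) (fun k hk => ?_) (fun k hk => ?_)
  · obtain ⟨h2, h3, -⟩ := iterate_primitive_two_pi hf
    have h0 : primitive^[3] φ (2 * Real.pi) = 0 := primitive_iterate_two_pi_eq_zero one_le_two h
    rw [h0] at h3
    obtain ⟨d₀, hd₀⟩ : ∃ d, d = primitive^[2] φ (2 * Real.pi) := ⟨_, rfl⟩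
    obtain ⟨d₁, hd₁⟩ : ∃ d, d = primitive φ (2 * Real.pi) := ⟨_, rfl⟩
    rw [← hd₀, ← hd₁] at h2 h3 hf
    have ht := add_half_mul_zetaTwo_tail_le n
    have hpi := Real.pi_gt_three
    -- Elimination of `d₁`. The bracket is positive: the tail term is at most `1` and `π² > 9 > 4`.
    have hb : d₀ * (Real.pi ^ 2 -
        4 * ((n + 1 / 2 : ℝ) * (Real.pi ^ 2 / 6 - zetaTwoSum n))) = 0 := by
      linear_combination (2 * Real.pi ^ 2 / 3 + 2 * zetaTwoSum n) * h2 - Real.pi * h3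
    have hd₀' : d₀ = 0 := (mul_eq_zero.1 hb).resolve_right (by nlinarith)
    have hd₁' : d₁ = 0 := by
      have h5 : d₁ * Real.pi = 0 := by rw [hd₀'] at h2; linarith
      exact (mul_eq_zero.1 h5).resolve_right Real.pi_ne_zero
    rw [hd₀', hd₁'] at hf
    exact eq_zero_of_ae_eq_dirichletComb hf
  · rw [integral_dirichletComb_mul_cos _ _ _ hk, integral_mul_cos_eq_primitive hi]
    refine (congrArg (fun z => _ + (k : ℝ) * z) (hS₁ k hk)).trans ?_
    simp [primitive]
  · rw [integral_dirichletComb_mul_sin _ _ _ hk, integral_mul_sin_eq_primitive hi]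
    exact congrArg (fun z => -((k : ℝ) * z)) (hC₁ k hk)

/-- Three unknowns `d₂`, `d₁`, `d₀`, the endpoint values of the first three primitives, and three
equations from primitives two, three and four. -/
theorem eq_zero_of_opA_three_mem_orthogonal (hφ : φ ∈ trigSpace n)
    (h : opA 3 φ ∈ (trigSpace n)ᗮ) : φ = 0 := by
  have hi := intervalIntegrable_of_memLp (Lp.memLp φ)
  have hi₁ := intervalIntegrable_primitive hi
  have hi₂ := intervalIntegrable_primitive hi₁
  have hp : 1 ≤ 3 := by norm_num
  have hC := fun k (hk : k ≤ n) => integral_iterate_mul_cos_eq_zero hp h hk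
  have hS := fun k (hk : k ≤ n) => integral_iterate_mul_sin_eq_zero hp h hk
  have hC₂ : ∀ k ≤ n, ∫ x in (0 : ℝ)..(2 * Real.pi),
      primitive (primitive φ) x * Real.cos (k * x) = primitive^[3] φ (2 * Real.pi) :=
    fun k hk => by
    rw [integral_mul_cos_eq_primitive hi₂]
    refine (congrArg (fun z => _ + (k : ℝ) * z) (hS k hk)).trans ?_
    simp [primitive]
  have hS₂ : ∀ k ≤ n, ∫ x in (0 : ℝ)..(2 * Real.pi),
      primitive (primitive φ) x * Real.sin (k * x) = 0 := fun k hk => by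
    rw [integral_mul_sin_eq_primitive hi₂]
    refine (congrArg (fun z => -((k : ℝ) * z)) (hC k hk)).trans ?_
    simp
  have hC₁ : ∀ k ≤ n, ∫ x in (0 : ℝ)..(2 * Real.pi), primitive φ x * Real.cos (k * x) =
      primitive^[2] φ (2 * Real.pi) := fun k hk => by
    rw [integral_mul_cos_eq_primitive hi₁]
    refine (congrArg (fun z => _ + (k : ℝ) * z) (hS₂ k hk)).trans ?_
    simp [primitive]
  have hS₁ : ∀ k ≤ n, ∫ x in (0 : ℝ)..(2 * Real.pi), primitive φ x * Real.sin (k * x) =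
      -(k * primitive^[3] φ (2 * Real.pi)) := fun k hk => by
    rw [integral_mul_sin_eq_primitive hi₁]
    exact congrArg (fun z => -((k : ℝ) * z)) (hC₂ k hk)
  have hf := ae_eq_of_moments hφ (IsTrig.dirichletComb (primitive φ (2 * Real.pi))
    (primitive^[2] φ (2 * Real.pi)) (primitive^[3] φ (2 * Real.pi)))
    (fun k hk => ?_) (fun k hk => ?_)
  · obtain ⟨h2, h3, h4⟩ := iterate_primitive_two_pi hf
    have h0 : primitive^[4] φ (2 * Real.pi) = 0 := primitive_iterate_two_pi_eq_zero hp h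
    rw [h0] at h4
    obtain ⟨d₀, hd₀⟩ : ∃ d, d = primitive^[3] φ (2 * Real.pi) := ⟨_, rfl⟩
    obtain ⟨d₁, hd₁⟩ : ∃ d, d = primitive^[2] φ (2 * Real.pi) := ⟨_, rfl⟩
    obtain ⟨d₂, hd₂⟩ : ∃ d, d = primitive φ (2 * Real.pi) := ⟨_, rfl⟩
    rw [← hd₀] at h3 h4 hf
    rw [← hd₁, ← hd₂] at h2 h3 h4 hf
    have ht := add_half_mul_zetaTwo_tail_le n
    have hpi := Real.pi_gt_three
    have hpi0 := Real.pi_ne_zero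
    obtain ⟨s, hs⟩ : ∃ s, s = zetaTwoSum n := ⟨_, rfl⟩
    rw [← hs] at h3 h4 ht
    -- This combination cancels `d₂` and the explicit factors `2n + 1` at once.
    have hq : Real.pi * d₀ + d₁ * (2 * s - Real.pi ^ 2 / 3) = 0 := by
      linear_combination Real.pi * h3 - h4 - Real.pi ^ 2 / 3 * h2
    -- Eliminating `d₂` and then `d₀` doubles the constant found for `p = 2`: the bracket is
    -- positive since `π² > 9 > 8`.
    have hb : d₁ * (Real.pi ^ 2 - 8 * ((n + 1 / 2 : ℝ) * (Real.pi ^ 2 / 6 - s))) = 0 := by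
      linear_combination (2 * Real.pi ^ 2 / 3 + 2 * s) * h2 - Real.pi * h3 + (2 * n + 1) * hq
    have hd₁' : d₁ = 0 := (mul_eq_zero.1 hb).resolve_right (by nlinarith)
    rw [hd₁'] at h2 hq
    have hd₀' : d₀ = 0 := by
      have h5 : Real.pi * d₀ = 0 := by linarith
      exact (mul_eq_zero.1 h5).resolve_left hpi0
    have hd₂' : d₂ = 0 := by
      have h5 : d₂ * Real.pi = 0 := by linarith
      exact (mul_eq_zero.1 h5).resolve_right hpi0
    rw [hd₂', hd₀', hd₁'] at hf
    exact eq_zero_of_ae_eq_dirichletComb hf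
  · rw [integral_dirichletComb_mul_cos _ _ _ hk, integral_mul_cos_eq_primitive hi]
    refine (congrArg (fun z => _ + (k : ℝ) * z) (hS₁ k hk)).trans ?_
    simp only [primitive]
    ring
  · rw [integral_dirichletComb_mul_sin _ _ _ hk, integral_mul_sin_eq_primitive hi]
    exact congrArg (fun z => -((k : ℝ) * z)) (hC₁ k hk)

theorem galerkinOp_injective {p : ℕ} (hp : p = 1 ∨ p = 2 ∨ p = 3) (n : ℕ) :
    Function.Injective (galerkinOp p n) := by
  rw [injective_iff_map_eq_zero]
  intro φ hφ
  have h : opA p φ ∈ (trigSpace n)ᗮ :=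
    Submodule.orthogonalProjectionOnto_eq_zero_iff.1 hφ
  refine Subtype.ext ?_
  rcases hp with rfl | rfl | rfl
  · exact eq_zero_of_opA_one_mem_orthogonal φ.2 h
  · exact eq_zero_of_opA_two_mem_orthogonal φ.2 h
  · exact eq_zero_of_opA_three_mem_orthogonal φ.2 h

end Injectivity

end NumDiff

end

theorem corollary5p2 (p : ℕ) (hp : p = 1 ∨ p = 2 ∨ p = 3) :
    Set.range (NumDiff.opA p) = NumDiff.sobolevH0 p ∧
    ∀ y : NumDiff.L2, y ∉ Set.range (NumDiff.opA p) →
      Filter.Tendsto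
        (fun n : ℕ => ‖NumDiff.moorePenroseInverse (NumDiff.galerkinOp p n) (NumDiff.projP n y)‖)
        Filter.atTop Filter.atTop :=
  ⟨NumDiff.range_opA (by omega), fun _ hy =>
    NumDiff.tendsto_norm_moorePenroseInverse_atTop (NumDiff.opA p) NumDiff.trigSpace
      NumDiff.trigSpace_mono NumDiff.top_le_topologicalClosure_iSup_trigSpace
      (NumDiff.galerkinOp p) (fun _ => rfl) (NumDiff.galerkinOp_injective hp) hy⟩
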